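/- **Setting.** Let $H(\mathbb T^n)=\mathbb C[z_1^{\pm1},\dots,z_n^{\pm1}]$ with its standard Hopf algebra structure ($z^k=\prod z_i^{k_i}$ group-like), and let $\mathcal A$ be a unital complex $*$-algebra which is a principal right $H(\mathbb T^n)$-comodule algebra with coaction $\Delta_R$: there is a linear $\ell:H(\mathbb T^n)\to\mathcal A\otimes\mathcal A$ with $\ell(1)=1\otimes1$, $m\circ\ell=\varepsilon$, $(\ell\otimes\mathrm{id})\Delta=(\mathrm{id}\otimes\Delta_R)\ell$ and $(S\otimes\ell)\Delta=(\sigma\otimes\mathrm{id})(\Delta_R\otimes\mathrm{id})\ell$, $\sigma$ being the flip $\mathcal A\otimes H(\mathbb T^n)\to H(\mathbb T^n)\otimes\mathcal A$. Put $\mathcal A^{(k)}=\{a:\Delta_R(a)=a\otimes z^k\}$ for $k\in\mathbb Z^n$, $\mathcal B=\mathcal A^{(0)}$, and let $\delta_j:\mathcal A\to\mathcal A$ be the derivation with $\delta_j(a)=k_ja$ on $\mathcal A^{(k)}$. Let $(\mathcal A,\mathcal H,D,J,\gamma)$ be a real spectral triple of $KR$-dimension $d$ ($\gamma=1$ if $d$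 is odd): $\mathcal A$ is represented by bounded operators on the Hilbert space $\mathcal H$; $D$ is self-adjoint, has bounded commutators with $\mathcal A$ (whose elements preserve $\mathrm{Dom}\,D$), and $D^{-1}$ is compact on $(\ker D)^\perp$; $J$ is antiunitary with $J^2=\epsilon$, $JD=\epsilon'DJ$, where $\epsilon=-1$ iff $d\equiv2,3,4,5\pmod 8$ and $\epsilon'=-1$ iff $d\equiv1\pmod 4$; for $d$ even $\gamma$ is a self-adjoint unitary commuting with $\mathcal A$ and anticommuting with $D$, and $J\gamma=\epsilon''\gamma J$, where $\epsilon''=-1$ iff $d\equiv2\pmod4$; moreover $[a,Jb^*J^{-1}]=0$ and $[[D,a],Jb^*J^{-1}]=0$ for all $a,b\in\mathcal A$. Put $ha=Ja^*J^{-1}h$ for $a\in\mathcal A$, and $h\eta=-\epsilon' J\eta^*J^{-1}h$ for one-forms $\eta$, so that $h[D,b]=D(hb)-(Dh)b$ for $h\in\mathrm{Dom}\,D$. For a subalgebra $\mathcal C\subseteq\mathcal A$ let $\Omega^1_D(\mathcal C)$ be the linear span of the operators $a[D,b]$, $a,b\in\mathcal C$, and write $da=[D,a]$. The triple is $\mathbb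 T^n$-equivariant: there are strongly commuting self-adjoint operators $\delta_1,\dots,\delta_n$ on $\mathcal H$, each with spectrum $\mathbb Z$ and with domain stable under $\mathcal A$, such that $\delta_j(a\psi)=\delta_j(a)\psi+a\,\delta_j\psi$, $\delta_jJ=-J\delta_j$, $[\delta_j,\gamma]=0$, and $\delta_j$ commutes strongly with $D$. (A self-adjoint operator commutes strongly with $T$ if its resolvents $R$ at non-real points satisfy $RT\subseteq TR$.) Let $\mathcal H_k=\{x:\delta_jx=k_jx\ \forall j\}$. The triple is projectable: there is a bounded $\Gamma=\Gamma^*$ with $\Gamma^2=1$, commuting with $\mathcal A$ and with all $\delta_j$, such that, if $d$ is odd, $J\Gamma=\Gamma J$ when $d-n\equiv0\pmod4$ and $J\Gamma=-\Gamma J$ otherwise, and, if $d$ is even, $J\Gamma=-\Gamma J$ and $\Gamma\gamma=(-1)^n\gamma\Gamma$. Put $D_h=\frac12\left(D+(-1)^n\Gamma D\Gamma\right)$. The fibres are isometric: $D=D_v+D_h+Z$ (as unbounded operators, with equality of domains), where $D_v$ vanishes on $\mathcal H_0\cap\mathrm{Dom}\,D_v$, commutes with $\Gamma$ for $n$ odd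 and anticommutes with $\Gamma$ for $n$ even, every $\delta_j$ commutes strongly with $D_v$, $Z$ is bounded and commutes with $\mathcal A$, and there is a bounded self-adjoint $Z'$ with $Ja^*J^{-1}Z=Z'Ja^*J^{-1}$ for all $a\in\mathcal A$. Let $D_0$ be the restriction of $D_h$ to $\mathcal H_0$. Let $\omega_1,\dots,\omega_n\in\Omega^1_D(\mathcal A)$ be a strong $\mathbb T^n$-connection: (i) $\delta_j(\omega_i)=0$, i.e. $\omega_i$ commutes with $\delta_j$ on $\mathcal H$; (ii) whenever $\omega_i=\sum_jp_j\,dq_j$, then $\sum_jp_j\delta_i(q_j)=1$ and $\sum_jp_j\delta_l(q_j)=0$ for $l\ne i$; (iii) $da-\sum_i\delta_i(a)\omega_i\in\Omega^1_D(\mathcal B)\mathcal A$ for all $a\in\mathcal A$. For $p\in\mathcal A^{(k)}$ put $\nabla_\omega(p)=[D,p]-\sum_ik_i\,p\,\omega_i$. **Proposition.** (1) For each $k\in\mathbb Z^n$ the rule $$D^{(k)}_\omega(hp)=(D_0h)p+h\nabla_\omega(p),\qquad h\in\mathrm{Dom}\,D_0,\ p\in\mathcal A^{(k)},$$ gives a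 well-defined linear operator on the linear span of these vectors $hp$, which is a dense subspace of $\mathcal H_k$, with values in $\mathcal H_k$. $\mathcal H$ is the Hilbert space direct sum of the $\mathcal H_k$, and the algebraic direct sum of the operators $D^{(k)}_\omega$ is closable. Let $D_\omega$ be its closure. (2) If all $\omega_i$ are self-adjoint, then $D_\omega$ is self-adjoint. (3) $D_\omega$ has bounded commutators with all elements of $\mathcal A$: every $a\in\mathcal A$ preserves $\mathrm{Dom}\,D_\omega$, and $[D_\omega,a]$ is the restriction to $\mathrm{Dom}\,D_\omega$ of a bounded operator on $\mathcal H$. -/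

import Mathlib

open scoped TensorProduct

noncomputable section

/-! ### Unbounded operators and commutation -/

section Operators

variable {H : Type*} [NormedAddCommGroup H] [InnerProductSpace ℂ H]

/-- `S` is the (everywhere defined, bounded) commutator `[T, a]`: the bounded operator `a` preserves
`Dom T` and `T a x - a T x = S x` for all `x ∈ Dom T`. -/
def IsCommutator (T : H →ₗ.[ℂ] H) (a S : H →L[ℂ] H) : Prop :=
  ∀ x : T.domain, ∃ h : a (x : H) ∈ T.domain, T ⟨a (x : H), h⟩ - a (T x) = S (x : H)

open Classical in
/-- The bounded extension of the commutator `[T, a]` (it is unique when `Dom T` is dense), and `0`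
when `[T, a]` is not bounded. -/
def boundedCommutator (T : H →ₗ.[ℂ] H) (a : H →L[ℂ] H) : H →L[ℂ] H :=
  if h : ∃ S, IsCommutator T a S then h.choose else 0

/-- `T j = c j T` for a conjugate-linear `j` (which in particular preserves `Dom T`). -/
def IntertwinesUpTo (c : ℤ) (T : H →ₗ.[ℂ] H) (j : H ≃ₗᵢ⋆[ℂ] H) : Prop :=
  ∀ x : T.domain, ∃ h : j (x : H) ∈ T.domain, T ⟨j (x : H), h⟩ = c • j (T x)

/-- `T a = c a T` for a bounded operator `a` (which in particular preserves `Dom T`). -/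
def CommutesUpTo (c : ℤ) (T : H →ₗ.[ℂ] H) (a : H →L[ℂ] H) : Prop :=
  ∀ x : T.domain, ∃ h : a (x : H) ∈ T.domain, T ⟨a (x : H), h⟩ = c • a (T x)

/-- `R = (T - z)⁻¹`. -/
def IsResolventAt (T : H →ₗ.[ℂ] H) (z : ℂ) (R : H →L[ℂ] H) : Prop :=
  (∀ y : H, ∃ h : R y ∈ T.domain, T ⟨R y, h⟩ - z • R y = y) ∧
    ∀ x : T.domain, R (T x - z • (x : H)) = x

/-- The spectrum of an unbounded operator: the complement of its resolvent set. -/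
def unboundedSpectrum (T : H →ₗ.[ℂ] H) : Set ℂ :=
  {z | ¬ ∃ R : H →L[ℂ] H, IsResolventAt T z R}

/-- A self-adjoint operator `S` commutes with a (possibly unbounded) operator `T`, in the usual
(strong) sense: the resolvents `R = (S - z)⁻¹`, `z ∉ ℝ`, satisfy `R T ⊆ T R`. -/
def StronglyCommutes (S T : H →ₗ.[ℂ] H) : Prop :=
  ∀ (z : ℂ) (R : H →L[ℂ] H), z.im ≠ 0 → IsResolventAt S z R →
    ∀ x : T.domain, ∃ h : R (x : H) ∈ T.domain, T ⟨R (x : H), h⟩ = R (T x)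

/-- The operator `T a` with domain `{x | a x ∈ Dom T}`, for `a` bounded. -/
def compBounded (T : H →ₗ.[ℂ] H) (a : H →L[ℂ] H) : H →ₗ.[ℂ] H where
  domain := T.domain.comap (a : H →ₗ[ℂ] H)
  toFun := T.toFun ∘ₗ (a : H →ₗ[ℂ] H).restrict (fun _ hx => hx)

/-- The operator `a T` with domain `Dom T`, for `a` bounded. -/
def boundedComp (a : H →L[ℂ] H) (T : H →ₗ.[ℂ] H) : H →ₗ.[ℂ] H :=
  (a : H →ₗ[ℂ] H).compPMap T

/-- The kernel of an unbounded operator. -/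
def unboundedKer (T : H →ₗ.[ℂ] H) : Submodule ℂ H :=
  (LinearMap.ker T.toFun).map T.domain.subtype

end Operators

/-! ### Principal comodule algebras over the Hopf algebra of the torus -/

/-- The Hopf algebra `H(𝕋ⁿ)`: Laurent polynomials in `n` commuting variables, that is, the group
algebra of `ℤⁿ`, with group-like monomials. -/
abbrev TorusHopf (n : ℕ) : Type := AddMonoidAlgebra ℂ (Fin n → ℤ)

/-- The monomial `z^k`. -/
def torusMonomial {n : ℕ} (k : Fin n → ℤ) : TorusHopf n := AddMonoidAlgebra.single k 1

/-- The linear functional `z^k ↦ k_j` on `H(𝕋ⁿ)`: the derivative at the unit along the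
`j`-th generator of the Lie algebra of `𝕋ⁿ`. -/
def torusLieGenerator {n : ℕ} (j : Fin n) : TorusHopf n →ₗ[ℂ] ℂ :=
  (Finsupp.lsum ℂ fun k : Fin n → ℤ => (k j : ℂ) • (LinearMap.id : ℂ →ₗ[ℂ] ℂ)) ∘ₗ
    (AddMonoidAlgebra.coeffLinearEquiv ℂ).toLinearMap

/-- A right `H(𝕋ⁿ)`-comodule algebra. -/
structure TorusComoduleAlgebra (n : ℕ) (A : Type*) [Ring A] [Algebra ℂ A] where
  /-- The coaction. -/
  coact : A →ₐ[ℂ] A ⊗[ℂ] TorusHopf n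
  coassoc : (TensorProduct.assoc ℂ A (TorusHopf n) (TorusHopf n)).toLinearMap ∘ₗ
      coact.toLinearMap.rTensor (TorusHopf n) ∘ₗ coact.toLinearMap =
    (Coalgebra.comul (R := ℂ) (A := TorusHopf n)).lTensor A ∘ₗ coact.toLinearMap
  counit : (TensorProduct.rid ℂ A).toLinearMap ∘ₗ
      (Coalgebra.counit (R := ℂ) (A := TorusHopf n)).lTensor A ∘ₗ coact.toLinearMap =
    LinearMap.id

namespace TorusComoduleAlgebra

variable {n : ℕ} {A : Type*} [Ring A] [Algebra ℂ A] (C : TorusComoduleAlgebra n A)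

/-- Principality: existence of a strong connection map `ℓ : H(𝕋ⁿ) → A ⊗ A`. -/
def IsPrincipal : Prop :=
  ∃ l : TorusHopf n →ₗ[ℂ] A ⊗[ℂ] A,
    l 1 = 1 ⊗ₜ[ℂ] 1 ∧
    (∀ h, LinearMap.mul' ℂ A (l h) =
      algebraMap ℂ A (Coalgebra.counit (R := ℂ) (A := TorusHopf n) h)) ∧
    (TensorProduct.assoc ℂ A A (TorusHopf n)).toLinearMap ∘ₗ
        l.rTensor (TorusHopf n) ∘ₗ Coalgebra.comul (R := ℂ) (A := TorusHopf n) =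
      C.coact.toLinearMap.lTensor A ∘ₗ l ∧
    TensorProduct.map (HopfAlgebra.antipode ℂ (A := TorusHopf n)) l ∘ₗ
        Coalgebra.comul (R := ℂ) (A := TorusHopf n) =
      (TensorProduct.assoc ℂ (TorusHopf n) A A).toLinearMap ∘ₗ
        (TensorProduct.comm ℂ A (TorusHopf n)).toLinearMap.rTensor A ∘ₗ
        C.coact.toLinearMap.rTensor A ∘ₗ l

/-- The homogeneous subspace `A^(k)`. -/
def homogeneous (k : Fin n → ℤ) : Submodule ℂ A :=
  LinearMap.eqLocus C.coact.toLinearMap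
    ((TensorProduct.mk ℂ A (TorusHopf n)).flip (torusMonomial k))

/-- The derivation `δ_j` of `A`; it is multiplication by `k_j` on `A^(k)`. -/
def deriv (j : Fin n) : A →ₗ[ℂ] A :=
  (TensorProduct.rid ℂ A).toLinearMap ∘ₗ (torusLieGenerator j).lTensor A ∘ₗ C.coact.toLinearMap

end TorusComoduleAlgebra

/-! ### Real spectral triples -/

/-- `J² = ε`. -/
def krEps (d : ℕ) : ℤ :=
  if d % 8 = 2 ∨ d % 8 = 3 ∨ d % 8 = 4 ∨ d % 8 = 5 then -1 else 1

/-- `J D = ε' D J`. -/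
def krEps' (d : ℕ) : ℤ := if d % 4 = 1 then -1 else 1

/-- `J γ = ε'' γ J` (for even dimension). -/
def krEps'' (d : ℕ) : ℤ := if d % 4 = 2 then -1 else 1

section Opposite

variable {H : Type*} [NormedAddCommGroup H] [InnerProductSpace ℂ H] [CompleteSpace H]

/-- `J T* J⁻¹` as a bounded operator. -/
def conjAdjoint (J : H ≃ₗᵢ⋆[ℂ] H) (T : H →L[ℂ] H) : H →L[ℂ] H :=
  (J.toContinuousLinearEquiv : H →L⋆[ℂ] H).comp
    ((ContinuousLinearMap.adjoint T).comp (J.symm.toContinuousLinearEquiv : H →L⋆[ℂ] H))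

end Opposite

/-- A real spectral triple of `KR`-dimension `d` (mod 8); in the odd case `γ = 1`. -/
structure RealSpectralTriple (A : Type*) [Ring A] [StarRing A] [Algebra ℂ A] [StarModule ℂ A]
    (H : Type*) [NormedAddCommGroup H] [InnerProductSpace ℂ H] [CompleteSpace H] (d : ℕ) where
  /-- The representation. -/
  π : A →⋆ₐ[ℂ] (H →L[ℂ] H)
  /-- The Dirac operator. -/
  D : H →ₗ.[ℂ] H
  /-- The real structure, an antiunitary operator. -/
  J : H ≃ₗᵢ⋆[ℂ] H
  /-- The grading. -/
  γ : H →L[ℂ] H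
  selfAdjoint : IsSelfAdjoint D
  bounded_commutator : ∀ a, ∃ S, IsCommutator D (π a) S
  /-- `D⁻¹` is compact on the orthogonal complement of the kernel. -/
  compact_inverse : ∃ K : H →L[ℂ] H, IsCompactOperator K ∧
    ∀ y ∈ (unboundedKer D)ᗮ, K y ∈ (unboundedKer D)ᗮ ∧
      ∃ h : K y ∈ D.domain, D ⟨K y, h⟩ = y
  J_sq : ∀ x, J (J x) = krEps d • x
  J_D : IntertwinesUpTo (krEps' d) D J
  commutant : ∀ a b, Commute (π a) (conjAdjoint J (π b))
  first_order : ∀ a b, Commute (boundedCommutator D (π a)) (conjAdjoint J (π b))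
  odd_grading : Odd d → γ = 1
  even_grading_sq : Even d → γ * γ = 1
  even_grading_selfAdjoint : Even d → IsSelfAdjoint γ
  even_grading_commute : Even d → ∀ a, Commute γ (π a)
  even_grading_D : Even d → CommutesUpTo (-1) D γ
  even_grading_J : Even d → ∀ x, J (γ x) = krEps'' d • γ (J x)

namespace RealSpectralTriple

variable {A : Type*} [Ring A] [StarRing A] [Algebra ℂ A] [StarModule ℂ A]
  {H : Type*} [NormedAddCommGroup H] [InnerProductSpace ℂ H] [CompleteSpace H] {d : ℕ}
  (T : RealSpectralTriple A H d)

/-- The differential `da = [D, a]`. -/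
def diff (a : A) : H →L[ℂ] H := boundedCommutator T.D (T.π a)

/-- The operator `h ↦ h a = J a* J⁻¹ h` of the right action of `A`. -/
def rightMul (a : A) : H →L[ℂ] H := conjAdjoint T.J (T.π a)

/-- The operator `h ↦ h η` of the right action of one-forms. The sign is the one for which
`h [D, b] = D (h b) - (D h) b`; it is `h η = - J η* J⁻¹ h` when `J D = D J`. -/
def rightForm (η : H →L[ℂ] H) : H →L[ℂ] H := (-krEps' d) • conjAdjoint T.J η

/-- The one-forms `Ω¹_D(B)` of a subspace `B` of `A`: the span of all `a [D, b]`, `a, b ∈ B`. -/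
def oneForms (B : Submodule ℂ A) : Submodule ℂ (H →L[ℂ] H) :=
  Submodule.span ℂ {η | ∃ a ∈ B, ∃ b ∈ B, η = T.π a * T.diff b}

/-- `Ω¹_D(B) A`. -/
def oneFormsMul (B : Submodule ℂ A) : Submodule ℂ (H →L[ℂ] H) :=
  Submodule.span ℂ {ζ | ∃ η ∈ T.oneForms B, ∃ a : A, ζ = η * T.π a}

/-- `𝕋ⁿ`-equivariance of a real spectral triple: the infinitesimal generators `δ_j` on `H`. -/
structure TorusEquivariance {n : ℕ} (C : TorusComoduleAlgebra n A) where
  /-- The generators. -/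
  δ : Fin n → H →ₗ.[ℂ] H
  selfAdjoint : ∀ j, IsSelfAdjoint (δ j)
  commute : ∀ i j, StronglyCommutes (δ i) (δ j)
  /-- `A` preserves `Dom δ_j` and `δ_j (a ψ) = δ_j(a) ψ + a δ_j ψ`. -/
  leibniz : ∀ j a, IsCommutator (δ j) (T.π a) (T.π (C.deriv j a))
  anticommute_J : ∀ j, IntertwinesUpTo (-1) (δ j) T.J
  commute_γ : ∀ j, CommutesUpTo 1 (δ j) T.γ
  commute_D : ∀ j, StronglyCommutes (δ j) T.D
  spectrum_eq : ∀ j, unboundedSpectrum (δ j) = Set.range (fun m : ℤ => (m : ℂ))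

/-- `D_h = ½ Γ (Γ D + (-1)ⁿ D Γ) = ½ (D + (-1)ⁿ Γ D Γ)`, with domain `{x ∈ Dom D | Γ x ∈ Dom D}`. -/
def horizontalDirac (n : ℕ) (Γ : H →L[ℂ] H) : H →ₗ.[ℂ] H :=
  (1 / 2 : ℂ) • boundedComp Γ (boundedComp Γ T.D + (-1 : ℂ) ^ n • compBounded T.D Γ)

namespace TorusEquivariance

variable {T} {n : ℕ} {C : TorusComoduleAlgebra n A} (E : T.TorusEquivariance C)

/-- The joint eigenspace `H_k = {x | δ_j x = k_j x for all j}`. -/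
def weightSpace (k : Fin n → ℤ) : Submodule ℂ H :=
  ⨅ j, (E.δ j).graph.comap (LinearMap.prod LinearMap.id ((k j : ℂ) • LinearMap.id))

/-- `Γ` is a grading along which the triple is projectable. -/
structure IsProjectable (Γ : H →L[ℂ] H) : Prop where
  sq : Γ * Γ = 1
  selfAdjoint : IsSelfAdjoint Γ
  commute_π : ∀ a, Commute Γ (T.π a)
  commute_δ : ∀ j, CommutesUpTo 1 (E.δ j) Γ
  /-- The base has dimension `d - n`. -/
  odd_J : Odd d → (d : ℤ) ≡ n [ZMOD 4] → ∀ x, T.J (Γ x) = Γ (T.J x)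
  odd_J' : Odd d → ¬ (d : ℤ) ≡ n [ZMOD 4] → ∀ x, T.J (Γ x) = -Γ (T.J x)
  even_J : Even d → ∀ x, T.J (Γ x) = -Γ (T.J x)
  even_γ : Even d → Γ * T.γ = (-1 : ℂ) ^ n • (T.γ * Γ)

/-- The isometric fibres condition. -/
def HasIsometricFibres (Γ : H →L[ℂ] H) : Prop :=
  ∃ (Dv : H →ₗ.[ℂ] H) (Z : H →L[ℂ] H),
    T.D = (Z : H →ₗ[ℂ] H) +ᵥ (Dv + T.horizontalDirac n Γ) ∧
    (∀ x : Dv.domain, (x : H) ∈ E.weightSpace 0 → Dv x = 0) ∧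
    CommutesUpTo (-(-1) ^ n) Dv Γ ∧
    (∀ j, StronglyCommutes (E.δ j) Dv) ∧
    (∀ a, Commute Z (T.π a)) ∧
    ∃ Z' : H →L[ℂ] H, IsSelfAdjoint Z' ∧ ∀ a, T.rightMul a * Z = Z' * T.rightMul a

/-- `D_0`, the restriction of the horizontal Dirac operator to `H_0`. -/
def baseDirac (Γ : H →L[ℂ] H) : H →ₗ.[ℂ] H :=
  (T.horizontalDirac n Γ).domRestrict (E.weightSpace 0)

/-- A strong `𝕋ⁿ`-connection for the Dirac calculus. The action of `δ_j` on a one-form `η` is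
the commutator `[δ_j, η]`. -/
structure IsStrongConnection (ω : Fin n → H →L[ℂ] H) : Prop where
  mem : ∀ i, ω i ∈ T.oneForms ⊤
  invariant : ∀ i j, IsCommutator (E.δ j) (ω i) 0
  vertical : ∀ (i : Fin n) (r : ℕ) (p q : Fin r → A), ω i = ∑ t, T.π (p t) * T.diff (q t) →
    ∀ l, ∑ t, p t * C.deriv l (q t) = if l = i then 1 else 0
  strong : ∀ a, T.diff a - ∑ i, T.π (C.deriv i a) * ω i ∈ T.oneFormsMul (C.homogeneous 0)

variable (Γ : H →L[ℂ] H) (ω : Fin n → H →L[ℂ] H)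

/-- The connection `∇_ω(p) = [D, p] - ∑ k_i p ω_i` on `A^(k)`. -/
def connection (k : Fin n → ℤ) (p : A) : H →L[ℂ] H :=
  T.diff p - ∑ i, (k i : ℂ) • (T.π p * ω i)

/-- The linear relation spanned by the prescription `h p ↦ (D_0 h) p + h ∇_ω(p)` for
`h ∈ Dom D_0` and `p ∈ A^(k)`. -/
def twistRelation (k : Fin n → ℤ) : Submodule ℂ (H × H) :=
  Submodule.span ℂ {v | ∃ (h : (E.baseDirac Γ).domain) (p : A), p ∈ C.homogeneous k ∧
    v = (T.rightMul p (h : H),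
      T.rightMul p (E.baseDirac Γ h) + T.rightForm (connection (T := T) ω k p) (h : H))}

/-- The twist `D_ω^(k)` of `D_0` by `∇_ω` on `A^(k)`. -/
def twist (k : Fin n → ℤ) : H →ₗ.[ℂ] H := (E.twistRelation Γ ω k).toLinearPMap

/-- The algebraic direct sum of the operators `D_ω^(k)`. -/
def twistSum : H →ₗ.[ℂ] H := (⨆ k, (E.twist Γ ω k).graph).toLinearPMap

/-- The twisted Dirac operator `D_ω`. -/
def twistedDirac : H →ₗ.[ℂ] H := (E.twistSum Γ ω).closure

end TorusEquivariance

end RealSpectralTriple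

end

/-! On each weight space the twisted operator is $D$ minus a bounded operator. On $\mathcal H_0$ the
vertical part vanishes, so $D_0=D-Z$ there. The right action commutes with $Z$ and satisfies
$h[D,p]=D(hp)-(Dh)p$ and $h(p\,\omega_i)=(hp)\omega_i$. The prescription therefore reads $hp\mapsto
(D-B_k)(hp)$ with $B_kx=Zx+\sum_i k_i\,x\omega_i$. Conversely, principality gives $1=\sum_t a_tb_t$
with $a_t$ of degree $-k$ and $b_t$ of degree $k$. Hence each $x\in\mathcal H_k\cap\mathrm{Dom}\,D$
equals $\sum_t (xa_t)b_t$ with $xa_t\in\mathrm{Dom}\,D_0$, and the span of the vectors $hp$ is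
exactly $\mathcal H_k\cap\mathrm{Dom}\,D$. This is `twistRelation_eq_blockGraph`; well-definedness
follows from it.

The rest is operator theory. `exists_jointProjections` supplies the projections onto the $\mathcal
H_k$, their totality, and the fact that they commute with $D$. Totality comes from the integer
spectrum through the functional calculus of a resolvent
(`IsSelfAdjoint.eq_zero_of_inner_eigenspace`), and commutation with closed operators from the mean
ergodic theorem (`exists_eigenprojection`). A direct sum of blocks $D-B_k$ is closable, and
essentially self-adjoint when the $B_k$ are self-adjoint (`isSelfAdjoint_closure_blockSum`); no
uniform bound on the $B_k$ is needed.

The norms of the $B_k$ may grow with $k$, yet commutators stay bounded: $a\in\mathcal A^{(l)}$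
commutes with $Z$ and, by the first-order condition, with the right action of $\omega_i$, so only
the difference $B_{k+l}-B_k$ enters, and it does not depend on $k$ (`commutator_mem_blockGraph`). -/

noncomputable section

/-! ### Graphs, resolvents and eigenspaces of unbounded operators -/

section UnboundedOperators

variable {H : Type*} [NormedAddCommGroup H] [InnerProductSpace ℂ H]

theorem LinearPMap.mem_graph_iff_exists {T : H →ₗ.[ℂ] H} {x y : H} :
    (x, y) ∈ T.graph ↔ ∃ h : x ∈ T.domain, T ⟨x, h⟩ = y := by
  rw [LinearPMap.mem_graph_iff]
  constructor
  · rintro ⟨⟨u, hu⟩, rfl, rfl⟩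
    exact ⟨hu, rfl⟩
  · rintro ⟨h, rfl⟩
    exact ⟨⟨x, h⟩, rfl, rfl⟩

/-- As a linear condition on the graph, free of domain proofs, the relation passes to sums of graphs
and to closures. -/
theorem isCommutator_iff_graph {T : H →ₗ.[ℂ] H} {a S : H →L[ℂ] H} :
    IsCommutator T a S ↔ ∀ x y, (x, y) ∈ T.graph → (a x, a y + S x) ∈ T.graph := by
  constructor
  · intro h x y hxy
    obtain ⟨hx, rfl⟩ := LinearPMap.mem_graph_iff_exists.1 hxy
    obtain ⟨h1, h2⟩ := h ⟨x, hx⟩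
    exact LinearPMap.mem_graph_iff_exists.2 ⟨h1, by rw [← h2]; abel⟩
  · intro h x
    obtain ⟨h1, h2⟩ := LinearPMap.mem_graph_iff_exists.1 (h x (T x) (T.mem_graph x))
    exact ⟨h1, by rw [h2]; abel⟩

theorem commutesUpTo_iff_graph {c : ℤ} {T : H →ₗ.[ℂ] H} {a : H →L[ℂ] H} :
    CommutesUpTo c T a ↔ ∀ x y, (x, y) ∈ T.graph → (a x, c • a y) ∈ T.graph := by
  constructor
  · intro h x y hxy
    obtain ⟨hx, rfl⟩ := LinearPMap.mem_graph_iff_exists.1 hxy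
    exact LinearPMap.mem_graph_iff_exists.2 (h ⟨x, hx⟩)
  · intro h x
    exact LinearPMap.mem_graph_iff_exists.1 (h x (T x) (T.mem_graph x))

theorem IntertwinesUpTo.mem_graph {c : ℤ} {T : H →ₗ.[ℂ] H} {j : H ≃ₗᵢ⋆[ℂ] H}
    (h : IntertwinesUpTo c T j) {x y : H} (hxy : (x, y) ∈ T.graph) :
    (j x, c • j y) ∈ T.graph := by
  obtain ⟨hx, rfl⟩ := LinearPMap.mem_graph_iff_exists.1 hxy
  exact LinearPMap.mem_graph_iff_exists.2 (h ⟨x, hx⟩)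

theorem StronglyCommutes.mem_graph {S T : H →ₗ.[ℂ] H} (h : StronglyCommutes S T) {z : ℂ}
    {R : H →L[ℂ] H} (hz : z.im ≠ 0) (hR : IsResolventAt S z R) {x y : H}
    (hxy : (x, y) ∈ T.graph) : (R x, R y) ∈ T.graph := by
  obtain ⟨hx, rfl⟩ := LinearPMap.mem_graph_iff_exists.1 hxy
  exact LinearPMap.mem_graph_iff_exists.2 (h z R hz hR ⟨x, hx⟩)

theorem IsResolventAt.mem_graph {T : H →ₗ.[ℂ] H} {z : ℂ} {R : H →L[ℂ] H}
    (h : IsResolventAt T z R) (y : H) : (R y, y + z • R y) ∈ T.graph := by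
  obtain ⟨h1, h2⟩ := h.1 y
  exact LinearPMap.mem_graph_iff_exists.2 ⟨h1, sub_eq_iff_eq_add.1 h2⟩

theorem IsResolventAt.apply_of_mem_graph {T : H →ₗ.[ℂ] H} {z : ℂ} {R : H →L[ℂ] H}
    (h : IsResolventAt T z R) {x y : H} (hxy : (x, y) ∈ T.graph) : R (y - z • x) = x := by
  obtain ⟨hx, rfl⟩ := LinearPMap.mem_graph_iff_exists.1 hxy
  exact h.2 ⟨x, hx⟩

/-- The eigenspace of an unbounded operator. -/
def unboundedEigenspace (T : H →ₗ.[ℂ] H) (m : ℂ) : Submodule ℂ H :=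
  T.graph.comap (LinearMap.prod LinearMap.id (m • LinearMap.id))

theorem mem_unboundedEigenspace {T : H →ₗ.[ℂ] H} {m : ℂ} {x : H} :
    x ∈ unboundedEigenspace T m ↔ (x, m • x) ∈ T.graph := Iff.rfl

theorem IsResolventAt.smul_apply_of_mem_eigenspace {T : H →ₗ.[ℂ] H} {z m : ℂ} {R : H →L[ℂ] H}
    (h : IsResolventAt T z R) {x : H} (hx : x ∈ unboundedEigenspace T m) :
    (m - z) • R x = x := by
  have := h.apply_of_mem_graph (mem_unboundedEigenspace.1 hx)
  rwa [← sub_smul, map_smul] at this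

theorem IsResolventAt.mem_eigenspace {T : H →ₗ.[ℂ] H} {z m : ℂ} {R : H →L[ℂ] H}
    (h : IsResolventAt T z R) {x : H} (hx : (m - z) • R x = x) :
    x ∈ unboundedEigenspace T m := by
  rw [mem_unboundedEigenspace]
  have h1 := T.graph.smul_mem (m - z) (h.mem_graph x)
  rw [Prod.smul_mk, hx, smul_add, smul_comm (m - z) z, hx, ← add_smul] at h1
  simpa using h1

/-- An operator commuting with the resolvents of `S` preserves the eigenspaces of `S`. -/
theorem StronglyCommutes.mem_eigenspace {S T : H →ₗ.[ℂ] H} (h : StronglyCommutes S T) {z : ℂ}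
    {R : H →L[ℂ] H} (hz : z.im ≠ 0) (hR : IsResolventAt S z R) {m : ℂ} {x y : H}
    (hx : x ∈ unboundedEigenspace S m) (hxy : (x, y) ∈ T.graph) :
    y ∈ unboundedEigenspace S m := by
  refine hR.mem_eigenspace ?_
  have h1 := T.graph.smul_mem (m - z) (h.mem_graph hz hR hxy)
  rw [Prod.smul_mk, hR.smul_apply_of_mem_eigenspace hx] at h1
  exact T.mem_graph_snd_inj h1 hxy rfl

theorem IsCommutator.mem_eigenspace {S : H →ₗ.[ℂ] H} {a s : H →L[ℂ] H} (h : IsCommutator S a s)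
    {c m : ℂ} (hs : s = c • a) {x : H} (hx : x ∈ unboundedEigenspace S m) :
    a x ∈ unboundedEigenspace S (m + c) := by
  have := isCommutator_iff_graph.1 h _ _ hx
  rw [mem_unboundedEigenspace, add_smul]
  simpa [hs] using this

variable [CompleteSpace H]

theorem IsSelfAdjoint.inner_graph {T : H →ₗ.[ℂ] H} (hT : IsSelfAdjoint T) {x y u v : H}
    (hxy : (x, y) ∈ T.graph) (huv : (u, v) ∈ T.graph) : inner ℂ y u = inner ℂ x v := by
  have h := LinearPMap.adjoint_graph_eq_graph_adjoint hT.dense_domain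
  rw [LinearPMap.isSelfAdjoint_def.1 hT] at h
  rw [h, Submodule.mem_adjoint_iff] at huv
  exact sub_eq_zero.1 (huv x y hxy)

/-- Maximality of a self-adjoint operator: its graph is already the whole adjoint graph. Domain
membership is obtained this way below. -/
theorem IsSelfAdjoint.mem_graph_of_inner {T : H →ₗ.[ℂ] H} (hT : IsSelfAdjoint T) {u v : H}
    (h : ∀ x y, (x, y) ∈ T.graph → inner ℂ y u = inner ℂ x v) : (u, v) ∈ T.graph := by
  have h' := LinearPMap.adjoint_graph_eq_graph_adjoint hT.dense_domain
  rw [LinearPMap.isSelfAdjoint_def.1 hT] at h'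
  rw [h', Submodule.mem_adjoint_iff]
  exact fun a b hab => sub_eq_zero.2 (h a b hab)

theorem IsSelfAdjoint.eq_zero_of_inner_domain {T : H →ₗ.[ℂ] H} (hT : IsSelfAdjoint T) {u : H}
    (h : ∀ x y, (x, y) ∈ T.graph → inner ℂ x u = 0) : u = 0 :=
  hT.dense_domain.eq_zero_of_inner_right ℂ fun x hx => h x _ (T.mem_graph ⟨x, hx⟩)

theorem IsSelfAdjoint.isClosed_graph {T : H →ₗ.[ℂ] H} (hT : IsSelfAdjoint T) :
    IsClosed (T.graph : Set (H × H)) := hT.isClosed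

theorem IsSelfAdjoint.isClosed_eigenspace {T : H →ₗ.[ℂ] H} (hT : IsSelfAdjoint T) (m : ℂ) :
    IsClosed (unboundedEigenspace T m : Set H) := by
  have : Continuous fun x : H => (x, m • x) := by fun_prop
  exact hT.isClosed_graph.preimage this

theorem IsSelfAdjoint.inner_eigenspace {T : H →ₗ.[ℂ] H} (hT : IsSelfAdjoint T) {m l : ℤ}
    (hml : m ≠ l) {x y : H} (hx : x ∈ unboundedEigenspace T m)
    (hy : y ∈ unboundedEigenspace T l) : inner ℂ x y = 0 := by
  have h := hT.inner_graph (mem_unboundedEigenspace.1 hx) (mem_unboundedEigenspace.1 hy)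
  rw [inner_smul_left, inner_smul_right, map_intCast] at h
  have : ((m : ℂ) - l) * inner ℂ x y = 0 := by rw [sub_mul, h, sub_self]
  exact (mul_eq_zero.1 this).resolve_left (sub_ne_zero.2 (by exact_mod_cast hml))

theorem IsCommutator.adjoint {T : H →ₗ.[ℂ] H} (hT : IsSelfAdjoint T) {a S : H →L[ℂ] H}
    (h : IsCommutator T a S) :
    IsCommutator T (ContinuousLinearMap.adjoint a) (-ContinuousLinearMap.adjoint S) := by
  rw [isCommutator_iff_graph] at h ⊢
  intro x y hxy
  refine hT.mem_graph_of_inner fun u v huv => ?_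
  have h1 := hT.inner_graph (h u v huv) hxy
  simp only [ContinuousLinearMap.adjoint_inner_right, inner_add_left, inner_add_right,
    neg_apply, inner_neg_right] at h1 ⊢
  rw [← h1]
  abel

/-- Mean ergodic theorem for the contraction `-i (S - m - i)⁻¹`: the projection onto an
eigenspace of `S` commutes with every closed operator that commutes with the resolvents. -/
theorem exists_eigenprojection {S : H →ₗ.[ℂ] H} (hS : IsSelfAdjoint S) (m : ℤ) {R : H →L[ℂ] H}
    (hR : IsResolventAt S (m + Complex.I) R) :
    ∃ P : H →L[ℂ] H, IsSelfAdjoint P ∧ (∀ x, P x ∈ unboundedEigenspace S m) ∧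
      (∀ x ∈ unboundedEigenspace S m, P x = x) ∧
      ∀ T : H →ₗ.[ℂ] H, IsClosed (T.graph : Set (H × H)) → StronglyCommutes S T →
        ∀ x y, (x, y) ∈ T.graph → (P x, P y) ∈ T.graph := by
  -- On the eigenvalue $m$ the resolvent at $m+i$ acts as $(-i)^{-1}$; the factor $-i$ turns
  -- eigenvectors into fixed vectors.
  set U : H →L[ℂ] H := (-Complex.I) • R with hU
  have hfix : U.eqLocus (1 : H →L[ℂ] H) = unboundedEigenspace S m := by
    ext x
    have e : (m : ℂ) - (m + Complex.I) = -Complex.I := by ring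
    constructor
    · intro hx
      exact hR.mem_eigenspace (by rw [e]; exact hx)
    · intro hx
      have := hR.smul_apply_of_mem_eigenspace hx
      rw [e] at this
      exact this
  have hnorm : ‖U‖ ≤ 1 := by
    refine ContinuousLinearMap.opNorm_le_bound _ zero_le_one fun y => ?_
    have h1 := hR.mem_graph y
    set u := R y with hu
    have hUy : ‖U y‖ = ‖u‖ := by simp [hU, hu, norm_smul]
    rw [hUy, one_mul]
    have h2 := hS.inner_graph h1 h1
    rw [inner_add_left, inner_add_right, inner_smul_left, inner_smul_right,
      inner_self_eq_norm_sq_to_K] at h2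
    -- Symmetry of $S$ at $u=Ry$ gives $-\mathrm{Im}\langle u,y\rangle=\|u\|^2$, and Cauchy–Schwarz
    -- then gives $\|u\|\le\|y\|$.
    have h3 : inner ℂ y u - inner ℂ u y = 2 * Complex.I * (‖u‖ : ℂ) ^ 2 := by
      simp only [map_add, Complex.conj_I, map_intCast] at h2
      linear_combination h2
    rw [← inner_conj_symm y u] at h3
    have h4 := congrArg Complex.im h3
    rw [Complex.sub_im, Complex.conj_im] at h4
    have h5 : (2 * Complex.I * (‖u‖ : ℂ) ^ 2).im = 2 * ‖u‖ ^ 2 := by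
      rw [show 2 * Complex.I * (‖u‖ : ℂ) ^ 2 = ((2 * ‖u‖ ^ 2 : ℝ) : ℂ) * Complex.I by
        push_cast; ring]
      rw [Complex.mul_I_im, Complex.ofReal_re]
    rw [h5] at h4
    have h6 : |(inner ℂ u y).im| ≤ ‖u‖ * ‖y‖ :=
      (Complex.abs_im_le_norm _).trans (norm_inner_le_norm u y)
    have h7 := neg_abs_le (inner ℂ u y).im
    by_contra hlt
    push Not at hlt
    have := norm_nonneg y
    nlinarith
  have : CompleteSpace (U.eqLocus (1 : H →L[ℂ] H)) := by
    rw [hfix]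
    exact (hS.isClosed_eigenspace _).completeSpace_coe
  refine ⟨(U.eqLocus (1 : H →L[ℂ] H)).starProjection, isSelfAdjoint_starProjection _,
    fun x => ?_, fun x hx => ?_, fun T hT hST x y hxy => ?_⟩
  · rw [← hfix]
    exact Submodule.starProjection_apply_mem _ x
  · exact Submodule.starProjection_eq_self_iff.2 (by rwa [hfix])
  · have hz : (m + Complex.I : ℂ).im ≠ 0 := by simp
    have hUT : ∀ v ∈ T.graph, (U v.1, U v.2) ∈ T.graph := fun v hv =>
      T.graph.smul_mem (-Complex.I) (hST.mem_graph hz hR (x := v.1) (y := v.2) hv)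
    have hit : ∀ j : ℕ, (U^[j] x, U^[j] y) ∈ T.graph := by
      intro j
      induction j with
      | zero => exact hxy
      | succ j ih =>
        rw [Function.iterate_succ_apply', Function.iterate_succ_apply']
        exact hUT _ ih
    -- The graph is stable under $U\times U$ and linear, so it contains the ergodic averages; being
    -- closed, it contains their limit $(Px,Py)$.
    have havg : ∀ N : ℕ, (birkhoffAverage ℂ U _root_.id N x, birkhoffAverage ℂ U _root_.id N y)
        ∈ T.graph := by
      intro N
      have : (birkhoffAverage ℂ U _root_.id N x, birkhoffAverage ℂ U _root_.id N y) =
          (N : ℂ)⁻¹ • ∑ j ∈ Finset.range N, (U^[j] x, U^[j] y) := by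
        rw [Prod.ext_iff]
        simp [birkhoffAverage, birkhoffSum, Prod.fst_sum, Prod.snd_sum]
      rw [this]
      exact T.graph.smul_mem _ (Submodule.sum_mem _ fun j _ => hit j)
    exact hT.mem_of_tendsto
      ((U.tendsto_birkhoffAverage_orthogonalProjection hnorm x).prodMk_nhds
        (U.tendsto_birkhoffAverage_orthogonalProjection hnorm y))
      (Filter.Eventually.of_forall havg)

end UnboundedOperators

/-! ### Totality of eigenvectors for integer spectrum -/

section SpectralTotality

variable {H : Type*} [NormedAddCommGroup H] [InnerProductSpace ℂ H]

/-- The resolvent identity. -/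
theorem IsResolventAt.sub_eq {S : H →ₗ.[ℂ] H} {z w : ℂ} {R Q : H →L[ℂ] H}
    (hR : IsResolventAt S z R) (hQ : IsResolventAt S w Q) : Q - R = (w - z) • (Q * R) := by
  ext x
  have h := hQ.apply_of_mem_graph (hR.mem_graph x)
  have e : x + z • R x - w • R x = x - (w - z) • R x := by rw [sub_smul]; abel
  rw [e, map_sub, map_smul] at h
  simp only [sub_apply, smul_apply, mul_apply_eq_comp]
  rw [sub_eq_iff_eq_add, ← sub_eq_iff_eq_add']
  exact h

/-- Spectral mapping for $R=(S-t)^{-1}$: a nonzero $s\in\sigma(R)$ forces $t+1/s\in\sigma(S)$, since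
a resolvent of $S$ at $t+1/s$ would yield an inverse of $s-R$. -/
theorem IsResolventAt.exists_of_mem_spectrum {S : H →ₗ.[ℂ] H} {t : ℝ}
    (hspec : unboundedSpectrum S ⊆ Set.range (fun m : ℤ => (m : ℂ)))
    {R : H →L[ℂ] H} (hR : IsResolventAt S t R) {s : ℝ} (hs : s ∈ spectrum ℝ R) (hs0 : s ≠ 0) :
    ∃ m : ℤ, s * (m - t) = 1 := by
  by_contra hne
  push Not at hne
  set w : ℂ := t + (s : ℂ)⁻¹ with hw
  have hsc : (s : ℂ) ≠ 0 := by exact_mod_cast hs0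
  have hwS : w ∉ unboundedSpectrum S := by
    intro hmem
    obtain ⟨m, hm⟩ := hspec hmem
    apply hne m
    have h1 : (s : ℂ) * (m - t) = 1 := by
      have : (m : ℂ) = t + (s : ℂ)⁻¹ := hm
      rw [this, add_sub_cancel_left, mul_inv_cancel₀ hsc]
    exact_mod_cast h1
  obtain ⟨Q, hQ⟩ := not_not.1 hwS
  have h1 := hR.sub_eq hQ
  have h2 := hQ.sub_eq hR
  have e : w - t = (s : ℂ)⁻¹ := by rw [hw]; ring
  have e' : (t : ℂ) - w = -(s : ℂ)⁻¹ := by rw [hw]; ring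
  rw [e] at h1
  rw [e'] at h2
  have h3 : Q * R = (s : ℂ) • (Q - R) := by rw [h1, smul_smul, mul_inv_cancel₀ hsc, one_smul]
  have h4 : R * Q = (s : ℂ) • (Q - R) := by
    rw [← neg_sub, h2, smul_neg, neg_smul, smul_neg, neg_neg, smul_smul, mul_inv_cancel₀ hsc,
      one_smul]
  apply hs
  have ha : algebraMap ℝ (H →L[ℂ] H) s = (s : ℂ) • 1 := by
    rw [Algebra.algebraMap_eq_smul_one]; ext x; simp
  -- Formally $(s-R)^{-1}=s^{-1}(S-t)(S-w)^{-1}$ with $w=t+1/s$, and $S-t=(S-w)+s^{-1}$.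
  let W : H →L[ℂ] H := (s : ℂ)⁻¹ • 1 + ((s : ℂ)⁻¹ * (s : ℂ)⁻¹) • Q
  have hs' : (s : ℂ) * ((s : ℂ)⁻¹ * (s : ℂ)⁻¹) = (s : ℂ)⁻¹ := by field_simp
  have hs'' : (s : ℂ)⁻¹ * (s : ℂ)⁻¹ * s = (s : ℂ)⁻¹ := by field_simp
  refine ⟨⟨algebraMap ℝ (H →L[ℂ] H) s - R, W, ?_, ?_⟩, rfl⟩
  · rw [ha]
    simp only [W, sub_mul, mul_add, smul_mul_assoc, one_mul, mul_smul_comm, h4, mul_one, smul_smul,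
      smul_sub, hs'', inv_mul_cancel₀ hsc, one_smul]
    abel
  · rw [ha]
    simp only [W, mul_sub, add_mul, smul_mul_assoc, one_mul, mul_smul_comm, h3, mul_one, smul_smul,
      smul_sub, hs', hs'', mul_inv_cancel₀ hsc, one_smul, smul_add]
    abel

variable [CompleteSpace H]

theorem IsSelfAdjoint.isSelfAdjoint_resolvent {S : H →ₗ.[ℂ] H} (hS : IsSelfAdjoint S) {t : ℝ}
    {R : H →L[ℂ] H} (hR : IsResolventAt S t R) : IsSelfAdjoint R := by
  rw [ContinuousLinearMap.isSelfAdjoint_iff_isSymmetric]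
  intro x y
  have h := hS.inner_graph (hR.mem_graph x) (hR.mem_graph y)
  rw [inner_add_left, inner_add_right, inner_smul_left, inner_smul_right, Complex.conj_ofReal] at h
  exact (add_right_cancel h).symm

/-- A continuous function of `s` that is `1` at `s = 1 / c` and vanishes at `0` and at all
`1 / (c + j)`, `j` a nonzero integer. -/
def resolventBump (c s : ℝ) : ℝ := max 0 (1 - (1 + |c|) * |s * c - 1|)

theorem continuous_resolventBump (c : ℝ) : Continuous (resolventBump c) := by
  unfold resolventBump
  fun_prop

theorem resolventBump_zero (c : ℝ) : resolventBump c 0 = 0 := by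
  have := abs_nonneg c
  simp [resolventBump]

theorem resolventBump_self {c s : ℝ} (h : s * c = 1) : resolventBump c s = 1 := by
  simp [resolventBump, h]

/-- Here $sc-1=-sj$, and $1=|s||c+j|\le|sj|(1+|c|)$ because $|j|\ge1$; this is what the factor
$1+|c|$ in the bump is for. -/
theorem resolventBump_of_ne {c s : ℝ} {j : ℤ} (hj : j ≠ 0) (h : s * (c + j) = 1) :
    resolventBump c s = 0 := by
  have hj1 : (1 : ℝ) ≤ |(j : ℝ)| := by exact_mod_cast Int.one_le_abs hj
  have e : s * c - 1 = -(s * j) := by linear_combination h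
  rw [resolventBump, e, abs_neg, abs_mul, max_eq_left]
  have h1 : |s| * |c + j| = 1 := by rw [← abs_mul, h, abs_one]
  have h2 : |c + j| ≤ |(j : ℝ)| * (1 + |c|) := by
    have := abs_add_le c (j : ℝ)
    have := abs_nonneg c
    nlinarith
  have := mul_le_mul_of_nonneg_left h2 (abs_nonneg s)
  rw [h1] at this
  linarith

/-- The eigenvectors of a self-adjoint operator with integer spectrum are total. -/
theorem IsSelfAdjoint.eq_zero_of_inner_eigenspace {S : H →ₗ.[ℂ] H} (hS : IsSelfAdjoint S)
    (hspec : unboundedSpectrum S ⊆ Set.range (fun m : ℤ => (m : ℂ))) {x : H}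
    (hx : ∀ m : ℤ, ∀ u ∈ unboundedEigenspace S m, inner ℂ u x = 0) : x = 0 := by
  -- The real point $1/2$ avoids the integers, so its resolvent is a bounded self-adjoint operator
  -- with a continuous functional calculus.
  have hhalf : ((1 / 2 : ℝ) : ℂ) ∉ unboundedSpectrum S := by
    intro h
    obtain ⟨m, hm⟩ := hspec h
    have hm' : (m : ℂ) = ((1 / 2 : ℝ) : ℂ) := hm
    have h1 : (m : ℝ) = 1 / 2 := by exact_mod_cast hm'
    have h2 : (2 * m : ℝ) = 1 := by rw [h1]; norm_num
    have h3 : 2 * m = 1 := by exact_mod_cast h2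
    omega
  obtain ⟨R, hR⟩ := not_not.1 hhalf
  have hRsa := hS.isSelfAdjoint_resolvent hR
  have hsp : ∀ s ∈ spectrum ℝ R, s = 0 ∨ ∃ m : ℤ, s * (m - 1 / 2) = 1 := fun s hs =>
    or_iff_not_imp_left.2 fun h0 => hR.exists_of_mem_spectrum hspec hs h0
  let φ : ℤ → ℝ → ℝ := fun m => resolventBump (m - 1 / 2)
  have hφc : ∀ m, Continuous (φ m) := fun m => continuous_resolventBump _
  have hφ : ∀ m l : ℤ, ∀ s : ℝ, s * (l - 1 / 2) = 1 → φ m s = if m = l then 1 else 0 := by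
    intro m l s hs
    split_ifs with h
    · subst h
      exact resolventBump_self hs
    · refine resolventBump_of_ne (j := l - m) (by omega) ?_
      push_cast
      linear_combination hs
  have hφ0 : ∀ m, φ m 0 = 0 := fun m => resolventBump_zero _
  have hmne : ∀ m : ℤ, (m - 1 / 2 : ℝ) ≠ 0 := by
    intro m h
    have h2 : (2 * m : ℝ) = 1 := by linarith
    have h3 : 2 * m = 1 := by exact_mod_cast h2
    omega
  -- On $\sigma(R)$ the function $\varphi_m$ is the indicator of $1/(m-1/2)$, so $\varphi_m(R)$ is a
  -- projection with range in the $m$-eigenspace, to which $x$ is orthogonal.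
  have hkill : ∀ m, cfc (φ m) R x = 0 := by
    intro m
    have hmul : R * cfc (φ m) R = (m - 1 / 2 : ℝ)⁻¹ • cfc (φ m) R := by
      have h1 : cfc (fun s => s * φ m s) R = R * cfc (φ m) R := by
        rw [cfc_mul (fun s => s) (φ m) R (by fun_prop) (hφc m).continuousOn, cfc_id' ℝ R]
      rw [← h1, ← cfc_smul _ (φ m) R (hφc m).continuousOn]
      refine cfc_congr fun s hs => ?_
      rcases hsp s hs with rfl | ⟨l, hl⟩
      · simp [hφ0]
      · simp only [hφ m l s hl, smul_eq_mul]
        split_ifs with h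
        · subst h
          rw [mul_one, mul_one]
          exact eq_inv_of_mul_eq_one_left hl
        · simp
    have hmem : ∀ y, cfc (φ m) R y ∈ unboundedEigenspace S m := by
      intro y
      refine hR.mem_eigenspace ?_
      have h1 : R (cfc (φ m) R y) = (m - 1 / 2 : ℝ)⁻¹ • cfc (φ m) R y :=
        congrArg (fun f : H →L[ℂ] H => f y) hmul
      have h2 : (m : ℂ) - ((1 / 2 : ℝ) : ℂ) = ((m - 1 / 2 : ℝ) : ℂ) := by push_cast; ring
      rw [h1, h2, Complex.coe_smul, smul_smul, mul_inv_cancel₀ (hmne m), one_smul]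
    have hidem : cfc (φ m) R * cfc (φ m) R = cfc (φ m) R := by
      rw [← cfc_mul (φ m) (φ m) R (hφc m).continuousOn (hφc m).continuousOn]
      refine cfc_congr fun s hs => ?_
      rcases hsp s hs with rfl | ⟨l, hl⟩
      · simp [hφ0]
      · simp only [hφ m l s hl]
        split_ifs <;> simp
    have hsa : IsSelfAdjoint (cfc (φ m) R) := cfc_predicate _ _
    rw [← inner_self_eq_zero (𝕜 := ℂ)]
    have h1 := (ContinuousLinearMap.isSelfAdjoint_iff_isSymmetric.1 hsa) (cfc (φ m) R x) x
    have h2 : cfc (φ m) R (cfc (φ m) R x) = cfc (φ m) R x :=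
      congrArg (fun f : H →L[ℂ] H => f x) hidem
    rw [ContinuousLinearMap.coe_coe, h2] at h1
    rw [← h1]
    exact hx m _ (hmem x)
  have hRx : R x = 0 := by
    -- Subtracting the killed components with $|m|\le N$ leaves a function of $R$ bounded by
    -- $\sup_{|l|>N}|l-1/2|^{-1}$; the extreme case is $l=N+1$.
    have hbound : ∀ N : ℕ, ‖R x‖ ≤ 1 / ((N : ℝ) + 1 / 2) * ‖x‖ := by
      intro N
      have hN : (0 : ℝ) < N + 1 / 2 := by positivity
      let F : Finset ℤ := Finset.Icc (-N) N
      let g : ℝ → ℝ := fun s => s - ∑ m ∈ F, ((m : ℝ) - 1 / 2)⁻¹ * φ m s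
      have hsumc : Continuous fun s => ∑ m ∈ F, ((m : ℝ) - 1 / 2)⁻¹ * φ m s :=
        continuous_finsetSum _ fun m _ => continuous_const.mul (hφc m)
      have hg : cfc g R = R - ∑ m ∈ F, (m - 1 / 2 : ℝ)⁻¹ • cfc (φ m) R := by
        have hfun : (fun s => ∑ m ∈ F, ((m : ℝ) - 1 / 2)⁻¹ * φ m s) =
            ∑ m ∈ F, fun s => ((m : ℝ) - 1 / 2)⁻¹ * φ m s := by
          ext s
          rw [Finset.sum_apply]
        rw [cfc_sub (fun s => s) _ R (by fun_prop) hsumc.continuousOn, cfc_id' ℝ R, hfun,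
          cfc_sum (fun (m : ℤ) s => (m - 1 / 2 : ℝ)⁻¹ * φ m s) R F
            (fun m _ => (continuous_const.mul (hφc m)).continuousOn)]
        congr 1
        refine Finset.sum_congr rfl fun m _ => ?_
        exact cfc_const_mul _ _ _ (hφc m).continuousOn
      have hgx : cfc g R x = R x := by
        rw [hg]
        simp [sum_apply, hkill]
      rw [← hgx]
      refine (ContinuousLinearMap.le_opNorm _ _).trans ?_
      gcongr
      refine norm_cfc_le (by positivity) fun s hs => ?_
      rcases hsp s hs with rfl | ⟨l, hl⟩
      · simp only [g, hφ0, mul_zero, Finset.sum_const_zero, sub_zero, norm_zero]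
        positivity
      · have hs1 : s = (l - 1 / 2 : ℝ)⁻¹ := eq_inv_of_mul_eq_one_left hl
        have hsum : ∑ m ∈ F, (m - 1 / 2 : ℝ)⁻¹ * φ m s = if l ∈ F then s else 0 := by
          simp only [hφ _ l s hl, mul_ite, mul_one, mul_zero]
          rw [Finset.sum_ite_eq' F l (fun m : ℤ => (m - 1 / 2 : ℝ)⁻¹), hs1]
        simp only [g, hsum]
        split_ifs with h
        · rw [sub_self, norm_zero]
          positivity
        · rw [sub_zero, hs1, Real.norm_eq_abs, abs_inv, one_div (_ + _)]
          refine inv_anti₀ hN ?_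
          have h1 : l < -N ∨ (N : ℤ) < l := by
            simp only [F, Finset.mem_Icc] at h
            omega
          rcases h1 with h1 | h1
          · have h2 : (l : ℝ) + 1 ≤ -N := by exact_mod_cast h1
            rw [abs_of_neg (by linarith)]
            linarith
          · have h2 : (N : ℝ) + 1 ≤ l := by exact_mod_cast h1
            rw [abs_of_pos (by linarith)]
            linarith
    have hlim : Filter.Tendsto (fun N : ℕ => 1 / ((N : ℝ) + 1 / 2) * ‖x‖) Filter.atTop (nhds 0) := by
      have h1 : Filter.Tendsto (fun N : ℕ => (N : ℝ) + 1 / 2) Filter.atTop Filter.atTop :=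
        Filter.tendsto_atTop_add_const_right _ _ tendsto_natCast_atTop_atTop
      have := (h1.inv_tendsto_atTop).mul_const ‖x‖
      simpa [one_div] using this
    exact norm_le_zero_iff.1 (ge_of_tendsto' hlim hbound)
  have := hR.mem_graph x
  rw [hRx, smul_zero, add_zero] at this
  exact S.graph_fst_eq_zero_snd this rfl

end SpectralTotality

/-! ### Grading of a torus comodule algebra and principality -/

section TorusAlgebra

variable {n : ℕ}

/-- The coefficient functional `z^l ↦ δ_{kl}`. -/
def torusCoeff (k : Fin n → ℤ) : TorusHopf n →ₗ[ℂ] ℂ :=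
  Finsupp.lapply k ∘ₗ (AddMonoidAlgebra.coeffLinearEquiv ℂ).toLinearMap

theorem torusCoeff_torusMonomial (k l : Fin n → ℤ) :
    torusCoeff k (torusMonomial l) = if l = k then 1 else 0 := by
  classical
  change (Finsupp.single l (1 : ℂ)) k = _
  rw [Finsupp.single_apply]

theorem torusLieGenerator_torusMonomial (j : Fin n) (k : Fin n → ℤ) :
    torusLieGenerator j (torusMonomial k) = (k j : ℂ) := by
  change (Finsupp.lsum ℂ fun k : Fin n → ℤ => (k j : ℂ) • (LinearMap.id : ℂ →ₗ[ℂ] ℂ))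
    (Finsupp.single k (1 : ℂ)) = _
  simp

theorem comul_torusMonomial (k : Fin n → ℤ) :
    Coalgebra.comul (R := ℂ) (torusMonomial k) = torusMonomial k ⊗ₜ[ℂ] torusMonomial k := by
  simp [torusMonomial]

theorem counit_torusMonomial (k : Fin n → ℤ) :
    Coalgebra.counit (R := ℂ) (torusMonomial k) = 1 := by
  simp [torusMonomial]

theorem antipode_torusMonomial (k : Fin n → ℤ) :
    HopfAlgebra.antipode ℂ (torusMonomial k) = torusMonomial (-k) := by
  simp [torusMonomial]

theorem torusHopf_induction {p : TorusHopf n → Prop} (x : TorusHopf n) (h0 : p 0)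
    (hadd : ∀ x y, p x → p y → p (x + y))
    (hsmul : ∀ (c : ℂ) k, p (c • torusMonomial k)) : p x := by
  induction x using AddMonoidAlgebra.induction_linear with
  | zero => exact h0
  | add x y hx hy => exact hadd x y hx hy
  | single k c =>
    have := hsmul c k
    rwa [torusMonomial, AddMonoidAlgebra.smul_single, smul_eq_mul, mul_one] at this

namespace TorusComoduleAlgebra

variable {A : Type*} [Ring A] [Algebra ℂ A] (C : TorusComoduleAlgebra n A)

theorem mem_homogeneous {k : Fin n → ℤ} {a : A} :
    a ∈ C.homogeneous k ↔ C.coact a = a ⊗ₜ[ℂ] torusMonomial k := Iff.rfl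

theorem deriv_of_mem_homogeneous {k : Fin n → ℤ} {a : A} (ha : a ∈ C.homogeneous k) (j : Fin n) :
    C.deriv j a = (k j : ℂ) • a := by
  simp [deriv, C.mem_homogeneous.1 ha, torusLieGenerator_torusMonomial]

/-- The component of degree `k`. -/
def component (k : Fin n → ℤ) : A →ₗ[ℂ] A :=
  (TensorProduct.rid ℂ A).toLinearMap ∘ₗ (torusCoeff k).lTensor A ∘ₗ C.coact.toLinearMap

/-- Apply the $k$-th coefficient to the last leg of coassociativity: on $H(\mathbb T^n)$ it turns
the coproduct into $h\mapsto h_k z^k$. -/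
theorem component_mem_homogeneous (k : Fin n → ℤ) (a : A) :
    C.component k a ∈ C.homogeneous k := by
  rw [mem_homogeneous]
  have h1 : ∀ t : A ⊗[ℂ] TorusHopf n,
      C.coact (TensorProduct.rid ℂ A ((torusCoeff k).lTensor A t)) =
      TensorProduct.rid ℂ _ ((torusCoeff k).lTensor _ (C.coact.toLinearMap.rTensor _ t)) := by
    intro t
    induction t with
    | zero => simp
    | add x y hx hy => simp only [map_add, hx, hy]
    | tmul a h => simp
  have h2 : ∀ t : (A ⊗[ℂ] TorusHopf n) ⊗[ℂ] TorusHopf n,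
      TensorProduct.rid ℂ _ ((torusCoeff k).lTensor _ t) =
      ((TensorProduct.rid ℂ _).toLinearMap ∘ₗ (torusCoeff k).lTensor (TorusHopf n)).lTensor A
        (TensorProduct.assoc ℂ A (TorusHopf n) (TorusHopf n) t) := by
    intro t
    induction t with
    | zero => simp
    | add x y hx hy => simp only [map_add, hx, hy]
    | tmul s h =>
      induction s with
      | zero => simp
      | add x y hx hy => simp only [map_add, TensorProduct.add_tmul, hx, hy]
      | tmul a g => simp
  have h3 : ∀ h : TorusHopf n, TensorProduct.rid ℂ _ ((torusCoeff k).lTensor (TorusHopf n)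
      (Coalgebra.comul (R := ℂ) h)) = torusCoeff k h • torusMonomial k := by
    intro h
    induction h using torusHopf_induction with
    | h0 => simp
    | hadd x y hx hy => simp only [map_add, hx, hy, add_smul]
    | hsmul c l =>
      rw [map_smul, comul_torusMonomial]
      simp only [map_smul, LinearMap.lTensor_tmul, torusCoeff_torusMonomial,
        TensorProduct.rid_tmul]
      split_ifs with hl
      · simp [hl]
      · simp
  have h4 : ∀ t : A ⊗[ℂ] TorusHopf n,
      ((TensorProduct.rid ℂ _).toLinearMap ∘ₗ (torusCoeff k).lTensor (TorusHopf n)).lTensor A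
        ((Coalgebra.comul (R := ℂ) (A := TorusHopf n)).lTensor A t) =
      (TensorProduct.rid ℂ A ((torusCoeff k).lTensor A t)) ⊗ₜ torusMonomial k := by
    intro t
    induction t with
    | zero => simp
    | add x y hx hy => simp only [map_add, hx, hy, TensorProduct.add_tmul]
    | tmul a h =>
      simp only [LinearMap.lTensor_tmul, LinearMap.comp_apply, LinearEquiv.coe_coe, h3,
        TensorProduct.rid_tmul, TensorProduct.tmul_smul, TensorProduct.smul_tmul']
  have h5 := congrArg (fun f => f a) C.coassoc
  simp only [LinearMap.comp_apply, LinearEquiv.coe_coe, AlgHom.toLinearMap_apply] at h5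
  simp only [component, LinearMap.comp_apply, LinearEquiv.coe_coe, AlgHom.toLinearMap_apply]
  rw [h1, h2, h5, h4]

/-- Every element is a sum of homogeneous elements. -/
theorem mem_iSup_homogeneous (a : A) : a ∈ ⨆ k, C.homogeneous k := by
  have h1 : ∀ t : A ⊗[ℂ] TorusHopf n, ∃ s : Finset (Fin n → ℤ), ∀ s', s ⊆ s' →
      TensorProduct.rid ℂ A ((Coalgebra.counit (R := ℂ) (A := TorusHopf n)).lTensor A t) =
        ∑ k ∈ s', TensorProduct.rid ℂ A ((torusCoeff k).lTensor A t) := by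
    classical
    intro t
    induction t with
    | zero => exact ⟨∅, by simp⟩
    | add x y hx hy =>
      obtain ⟨s, hs⟩ := hx
      obtain ⟨r, hr⟩ := hy
      refine ⟨s ∪ r, fun s' hs' => ?_⟩
      simp only [map_add, Finset.sum_add_distrib]
      rw [hs s' (Finset.union_subset_left hs'), hr s' (Finset.union_subset_right hs')]
    | tmul a h =>
      induction h using torusHopf_induction with
      | h0 => exact ⟨∅, by simp⟩
      | hadd x y hx hy =>
        obtain ⟨s, hs⟩ := hx
        obtain ⟨r, hr⟩ := hy
        refine ⟨s ∪ r, fun s' hs' => ?_⟩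
        simp only [TensorProduct.tmul_add, map_add, Finset.sum_add_distrib]
        rw [hs s' (Finset.union_subset_left hs'), hr s' (Finset.union_subset_right hs')]
      | hsmul c l =>
        refine ⟨{l}, fun s' hs' => ?_⟩
        have hl : l ∈ s' := hs' (by simp)
        simp only [LinearMap.lTensor_tmul, map_smul, counit_torusMonomial,
          torusCoeff_torusMonomial, TensorProduct.rid_tmul, TensorProduct.tmul_smul]
        simp [hl]
  obtain ⟨s, hs⟩ := h1 (C.coact a)
  have h2 := congrArg (fun f => f a) C.counit
  simp only [LinearMap.comp_apply, LinearEquiv.coe_coe, AlgHom.toLinearMap_apply,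
    LinearMap.id_apply] at h2
  rw [hs s subset_rfl] at h2
  rw [← h2]
  exact Submodule.sum_mem _ fun k _ =>
    Submodule.mem_iSup_of_mem k (C.component_mem_homogeneous k a)

/-- In a principal comodule algebra the unit is a finite sum of products of elements of opposite
degrees. -/
theorem IsPrincipal.exists_sum_eq_one {C : TorusComoduleAlgebra n A} (hC : C.IsPrincipal)
    (k : Fin n → ℤ) : ∃ (r : ℕ) (a b : Fin r → A), (∀ t, a t ∈ C.homogeneous (-k)) ∧
      (∀ t, b t ∈ C.homogeneous k) ∧ ∑ t, a t * b t = 1 := by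
  obtain ⟨l, -, hm, hr, hl⟩ := hC
  have hr' := congrArg (fun f => f (torusMonomial k)) hr
  have hl' := congrArg (fun f => f (torusMonomial k)) hl
  simp only [LinearMap.comp_apply, comul_torusMonomial, LinearMap.rTensor_tmul,
    TensorProduct.map_tmul, antipode_torusMonomial, LinearEquiv.coe_coe] at hr' hl'
  set w := l (torusMonomial k)
  have e1 : ∀ t : A ⊗[ℂ] A, ((TensorProduct.rid ℂ A).toLinearMap ∘ₗ
      (torusCoeff k).lTensor A).lTensor A (C.coact.toLinearMap.lTensor A t) =
      (C.component k).lTensor A t := by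
    intro t
    induction t with
    | zero => simp
    | add x y hx hy => simp only [map_add, hx, hy]
    | tmul a b => simp [component]
  have e2 : ∀ t : A ⊗[ℂ] A, ((TensorProduct.rid ℂ A).toLinearMap ∘ₗ
      (torusCoeff k).lTensor A).lTensor A (TensorProduct.assoc ℂ A A (TorusHopf n)
        (t ⊗ₜ torusMonomial k)) = t := by
    intro t
    induction t with
    | zero => simp
    | add x y hx hy => simp only [map_add, TensorProduct.add_tmul, hx, hy]
    | tmul a b => simp [torusCoeff_torusMonomial]
  have e3 : ∀ t : A ⊗[ℂ] A, TensorProduct.lid ℂ _ ((torusCoeff (-k)).rTensor (A ⊗[ℂ] A)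
      (TensorProduct.assoc ℂ (TorusHopf n) A A ((TensorProduct.comm ℂ A
        (TorusHopf n)).toLinearMap.rTensor A (C.coact.toLinearMap.rTensor A t)))) =
      (C.component (-k)).rTensor A t := by
    intro t
    induction t with
    | zero => simp
    | add x y hx hy => simp only [map_add, hx, hy]
    | tmul a b =>
      simp only [LinearMap.rTensor_tmul, component, LinearMap.comp_apply, AlgHom.toLinearMap_apply]
      induction C.coact a with
      | zero => simp
      | add x y hx hy => simp only [map_add, TensorProduct.add_tmul, hx, hy]
      | tmul c h => simp [TensorProduct.smul_tmul']
  -- The two colinearity conditions on $\ell(z^k)$ say that its right leg has degree $k$ and,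
  -- through the antipode, its left leg degree $-k$.
  have f1 : (C.component k).lTensor A w = w := by rw [← e1, ← hr', e2]
  have f2 : (C.component (-k)).rTensor A w = w := by
    rw [← e3, ← hl']
    simp [torusCoeff_torusMonomial]
  have hmw := hm (torusMonomial k)
  rw [counit_torusMonomial, map_one] at hmw
  have h3 : ∀ t : A ⊗[ℂ] A, ∃ (r : ℕ) (a b : Fin r → A), (∀ t, a t ∈ C.homogeneous (-k)) ∧
      (∀ t, b t ∈ C.homogeneous k) ∧ ∑ t, a t * b t = LinearMap.mul' ℂ A
        ((C.component (-k)).rTensor A ((C.component k).lTensor A t)) := by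
    intro t
    induction t with
    | zero => exact ⟨0, Fin.elim0, Fin.elim0, fun t => t.elim0, fun t => t.elim0, by simp⟩
    | add x y hx hy =>
      obtain ⟨r, a, b, ha, hb, h⟩ := hx
      obtain ⟨r', a', b', ha', hb', h'⟩ := hy
      refine ⟨r + r', Fin.append a a', Fin.append b b', fun t => ?_, fun t => ?_, ?_⟩
      · induction t using Fin.addCases <;> simp [ha, ha']
      · induction t using Fin.addCases <;> simp [hb, hb']
      · rw [Fin.sum_univ_add]
        simp [h, h']
    | tmul a b =>
      exact ⟨1, fun _ => C.component (-k) a, fun _ => C.component k b,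
        fun _ => C.component_mem_homogeneous _ _, fun _ => C.component_mem_homogeneous _ _,
        by simp⟩
  obtain ⟨r, a, b, ha, hb, h⟩ := h3 w
  refine ⟨r, a, b, ha, hb, ?_⟩
  rw [h, f1, f2]
  exact hmw

end TorusComoduleAlgebra
end TorusAlgebra

/-! ### Joint spectral projections of commuting generators -/

section JointProjections

variable {H : Type*} [NormedAddCommGroup H] [InnerProductSpace ℂ H]

theorem exists_resolvent_of_integer_spectrum {S : H →ₗ.[ℂ] H}
    (hspec : unboundedSpectrum S ⊆ Set.range (fun m : ℤ => (m : ℂ))) (m : ℤ) :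
    ∃ R : H →L[ℂ] H, IsResolventAt S (m + Complex.I) R := by
  refine not_not.1 fun h => ?_
  obtain ⟨l, hl⟩ := hspec h
  simpa using congrArg Complex.im hl

variable [CompleteSpace H]

/-- The projections onto the joint eigenspaces of a finite family of strongly commuting self-adjoint
operators with integer spectra. -/
theorem exists_jointProjections {ι : Type*} [DecidableEq ι] {δ : ι → H →ₗ.[ℂ] H}
    (hδ : ∀ j, IsSelfAdjoint (δ j)) (hc : ∀ i j, StronglyCommutes (δ i) (δ j))
    (hspec : ∀ j, unboundedSpectrum (δ j) ⊆ Set.range (fun m : ℤ => (m : ℂ))) (s : Finset ι) :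
    ∃ Q : (ι → ℤ) → H →L[ℂ] H, (∀ k, IsSelfAdjoint (Q k)) ∧
      (∀ k x, ∀ j ∈ s, Q k x ∈ unboundedEigenspace (δ j) (k j)) ∧
      (∀ k x, (∀ j ∈ s, x ∈ unboundedEigenspace (δ j) (k j)) → Q k x = x) ∧
      (∀ T : H →ₗ.[ℂ] H, IsClosed (T.graph : Set (H × H)) → (∀ j, StronglyCommutes (δ j) T) →
        ∀ k x y, (x, y) ∈ T.graph → (Q k x, Q k y) ∈ T.graph) ∧
      (∀ x, (∀ k, Q k x = 0) → x = 0) ∧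
      (∀ k k', (∀ j ∈ s, k j = k' j) → Q k = Q k') := by
  induction s using Finset.induction_on with
  | empty =>
    refine ⟨fun _ => 1, fun _ => .one _, by simp, by simp, fun T _ _ k x y h => h,
      fun x hx => hx 0, fun _ _ _ => rfl⟩
  | insert a s has ih =>
    obtain ⟨Q, hQsa, hQmem, hQid, hQT, hQtot, hQloc⟩ := ih
    choose R hR using fun m => exists_resolvent_of_integer_spectrum (hspec a) m
    choose P hPsa hPmem hPid hPT using fun m => exists_eigenprojection (hδ a) m (hR m)
    -- $Q_k$ preserves the range of $P_m$, so $P_mQ_kP_m=Q_kP_m$; the left side is self-adjoint,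
    -- hence so is the right.
    have hcomm : ∀ m k, P m * Q k = Q k * P m := by
      intro m k
      have h1 : P m * Q k * P m = Q k * P m := by
        ext x
        exact hPid m _ (by
          have := hQT (δ a) (hδ a).isClosed_graph (fun j => hc j a) k _ _ (hPmem m x)
          rw [mem_unboundedEigenspace]
          simpa using this)
      have h2 := congrArg star h1
      simp only [star_mul, (hPsa m).star_eq, (hQsa k).star_eq] at h2
      rw [← h2, ← mul_assoc, h1]
    refine ⟨fun k => P (k a) * Q k, fun k => ?_, fun k x j hj => ?_, fun k x hx => ?_,
      fun T hT hδT k x y hxy => ?_, fun x hx => ?_, fun k k' hk => ?_⟩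
    · simp only [isSelfAdjoint_iff, star_mul, (hPsa _).star_eq, (hQsa _).star_eq, hcomm]
    · rcases Finset.mem_insert.1 hj with rfl | hj
      · exact hPmem _ _
      · simp only [hcomm]
        exact hQmem k _ j hj
    · change P (k a) (Q k x) = x
      rw [hQid k x fun j hj => hx j (Finset.mem_insert_of_mem hj)]
      exact hPid _ _ (hx a (Finset.mem_insert_self _ _))
    · exact hPT _ T hT (hδT a) _ _ (hQT T hT hδT k x y hxy)
    · refine hQtot x fun k => ?_
      refine (hδ a).eq_zero_of_inner_eigenspace (hspec a) fun m u hu => ?_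
      have h1 : P m (Q k x) = 0 := by
        -- $Q$ ignores the coordinate $a$, so that coordinate can be set to any $m$ without changing
        -- $Q_k$.
        have : P (Function.update k a m a) (Q (Function.update k a m) x) = 0 :=
          hx (Function.update k a m)
        rw [hQloc (Function.update k a m) k fun j hj =>
          Function.update_of_ne (by rintro rfl; exact has hj) _ _] at this
        simpa using this
      have h2 := (ContinuousLinearMap.isSelfAdjoint_iff_isSymmetric.1 (hPsa m)) u (Q k x)
      simp only [ContinuousLinearMap.coe_coe, h1, inner_zero_right, hPid m u hu] at h2
      exact h2
    · change P (k a) * Q k = P (k' a) * Q k'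
      rw [hk a (Finset.mem_insert_self _ _),
        hQloc k k' fun j hj => hk j (Finset.mem_insert_of_mem hj)]

end JointProjections

/-! ### Hilbert sums of bounded perturbations of the parts of $D$ -/

section BlockOperators

variable {H : Type*} [NormedAddCommGroup H] [InnerProductSpace ℂ H]

/-- The graph of the restriction of `D - B` to `K`. -/
def blockGraph (D : H →ₗ.[ℂ] H) (K : Submodule ℂ H) (B : H →L[ℂ] H) : Submodule ℂ (H × H) :=
  K.comap (LinearMap.fst ℂ H H) ⊓ D.graph.comap
    (LinearMap.prod (LinearMap.fst ℂ H H) (LinearMap.snd ℂ H H + B ∘ₗ LinearMap.fst ℂ H H))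

theorem mem_blockGraph {D : H →ₗ.[ℂ] H} {K : Submodule ℂ H} {B : H →L[ℂ] H} {x y : H} :
    (x, y) ∈ blockGraph D K B ↔ x ∈ K ∧ (x, y + B x) ∈ D.graph := Iff.rfl

theorem snd_mem_of_mem_blockGraph {D : H →ₗ.[ℂ] H} {K : Submodule ℂ H} {B : H →L[ℂ] H}
    (hDK : ∀ x ∈ K, ∀ y, (x, y) ∈ D.graph → y ∈ K) (hB : ∀ x ∈ K, B x ∈ K) {v : H × H}
    (hv : v ∈ blockGraph D K B) : v.2 ∈ K := by
  obtain ⟨h1, h2⟩ := mem_blockGraph.1 hv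
  have := K.sub_mem (hDK _ h1 _ h2) (hB _ h1)
  rwa [add_sub_cancel_right] at this

variable [CompleteSpace H]

/-- A family of self-adjoint projections onto mutually orthogonal subspaces with dense sum. -/
structure IsProjectionFamily {ι : Type*} (K : ι → Submodule ℂ H) (Q : ι → H →L[ℂ] H) :
    Prop where
  selfAdjoint : ∀ k, IsSelfAdjoint (Q k)
  mem : ∀ k x, Q k x ∈ K k
  apply_of_mem : ∀ k, ∀ x ∈ K k, Q k x = x
  total : ∀ x, (∀ k, Q k x = 0) → x = 0
  orthogonal : ∀ k l, k ≠ l → ∀ x ∈ K k, ∀ y ∈ K l, inner ℂ x y = 0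

namespace IsProjectionFamily

variable {ι : Type*} {K : ι → Submodule ℂ H} {Q : ι → H →L[ℂ] H} (hQ : IsProjectionFamily K Q)
include hQ

theorem inner_left (k : ι) (x y : H) : inner ℂ (Q k x) y = inner ℂ x (Q k y) :=
  (ContinuousLinearMap.isSelfAdjoint_iff_isSymmetric.1 (hQ.selfAdjoint k)) x y

theorem apply_of_mem_of_ne {k l : ι} (h : k ≠ l) {x : H} (hx : x ∈ K l) : Q k x = 0 := by
  rw [← inner_self_eq_zero (𝕜 := ℂ), hQ.inner_left, hQ.apply_of_mem _ _ (hQ.mem k x),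
    ← inner_conj_symm, hQ.orthogonal k l h _ (hQ.mem k x) x hx, map_zero]

theorem eq_zero_of_inner {x : H} (h : ∀ k, ∀ u ∈ K k, inner ℂ u x = 0) : x = 0 := by
  refine hQ.total x fun k => ?_
  rw [← inner_self_eq_zero (𝕜 := ℂ), hQ.inner_left, hQ.apply_of_mem _ _ (hQ.mem k x),
    ← inner_conj_symm, h k _ (hQ.mem k x), map_zero]

theorem topologicalClosure_iSup : (⨆ k, K k).topologicalClosure = ⊤ := by
  rw [Submodule.topologicalClosure_eq_top_iff, Submodule.eq_bot_iff]
  intro x hx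
  refine hQ.eq_zero_of_inner fun k u hu => ?_
  exact (Submodule.mem_orthogonal _ _).1 hx u (Submodule.mem_iSup_of_mem k hu)

theorem orthogonalFamily :
    OrthogonalFamily ℂ (fun k => K k) (fun k => (K k).subtypeₗᵢ) :=
  fun _ _ h x y => hQ.orthogonal _ _ h _ x.2 _ y.2

/-- The partial sums eventually fix each vector of the dense algebraic sum, and $1-\sum_{k\in F}Q_k$
is a contraction by Pythagoras; approximation gives the limit. -/
theorem tendsto_sum (x : H) :
    Filter.Tendsto (fun F : Finset ι => ∑ k ∈ F, Q k x) Filter.atTop (nhds x) := by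
  classical
  have hfix : ∀ v ∈ ⨆ k, K k, ∃ F₀ : Finset ι, ∀ F, F₀ ⊆ F → ∑ k ∈ F, Q k v = v := by
    intro v hv
    induction hv using Submodule.iSup_induction' with
    | mem k v hv =>
      refine ⟨{k}, fun F hF => ?_⟩
      rw [Finset.sum_eq_single k (fun l _ hl => hQ.apply_of_mem_of_ne hl hv)
        (fun h => absurd (hF (by simp)) h), hQ.apply_of_mem k v hv]
    | zero => exact ⟨∅, by simp⟩
    | add v w _ _ hv hw =>
      obtain ⟨F₀, h0⟩ := hv
      obtain ⟨F₁, h1⟩ := hw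
      refine ⟨F₀ ∪ F₁, fun F hF => ?_⟩
      simp only [map_add, Finset.sum_add_distrib]
      rw [h0 F (Finset.union_subset_left hF), h1 F (Finset.union_subset_right hF)]
  have hcontr : ∀ (F : Finset ι) (y : H), ‖y - ∑ k ∈ F, Q k y‖ ≤ ‖y‖ := by
    intro F y
    have horth : inner ℂ (∑ k ∈ F, Q k y) (y - ∑ k ∈ F, Q k y) = 0 := by
      rw [sum_inner]
      refine Finset.sum_eq_zero fun k hk => ?_
      have h1 : Q k (∑ l ∈ F, Q l y) = Q k y := by
        rw [map_sum, Finset.sum_eq_single k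
          (fun l _ hl => hQ.apply_of_mem_of_ne (Ne.symm hl) (hQ.mem l y)) (fun h => absurd hk h),
          hQ.apply_of_mem _ _ (hQ.mem k y)]
      rw [hQ.inner_left, map_sub, h1, sub_self, inner_zero_right]
    have h2 := norm_add_sq_eq_norm_sq_add_norm_sq_of_inner_eq_zero _ _ horth
    rw [add_sub_cancel] at h2
    have := norm_nonneg (∑ k ∈ F, Q k y)
    have := norm_nonneg y
    nlinarith
  rw [Metric.tendsto_atTop]
  intro ε hε
  have hx : x ∈ (⨆ k, K k).topologicalClosure := by
    rw [hQ.topologicalClosure_iSup]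
    trivial
  obtain ⟨v, hv, hxv⟩ := Metric.mem_closure_iff.1 hx ε hε
  obtain ⟨F₀, h0⟩ := hfix v hv
  refine ⟨F₀, fun F hF => ?_⟩
  rw [dist_comm, dist_eq_norm]
  have h1 := hcontr F (x - v)
  simp only [map_sub, Finset.sum_sub_distrib, h0 F hF] at h1
  rw [sub_sub_sub_cancel_right] at h1
  exact h1.trans_lt (by rwa [← dist_eq_norm])

variable {D : H →ₗ.[ℂ] H} {B : ι → H →L[ℂ] H}

/-- The block sum has a formal adjoint on the vectors of $K_k\cap\mathrm{Dom}\,D$, sending $x$ to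
$Q_k(Dx-B_k^*x)$. These vectors are total, so a limit $(0,y)$ of graph points has $y=0$.
Self-adjointness of the $B_k$ plays no role. -/
theorem eq_zero_of_mem_closure_blockGraph (hD : IsSelfAdjoint D)
    (hQD : ∀ k x y, (x, y) ∈ D.graph → (Q k x, Q k y) ∈ D.graph)
    (hDK : ∀ k, ∀ x ∈ K k, ∀ y, (x, y) ∈ D.graph → y ∈ K k)
    (hB : ∀ k, ∀ x ∈ K k, B k x ∈ K k) {v : H × H}
    (hv : v ∈ (⨆ k, blockGraph D (K k) (B k)).topologicalClosure) (hv0 : v.1 = 0) :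
    v.2 = 0 := by
  have key : ∀ k x y, x ∈ K k → (x, y) ∈ D.graph →
      inner ℂ x v.2 = inner ℂ (Q k (y - ContinuousLinearMap.adjoint (B k) x)) v.1 := by
    intro k x y hx hxy
    refine closure_minimal (s := ((⨆ k, blockGraph D (K k) (B k) : Submodule ℂ (H × H)) :
      Set (H × H))) (t := {v : H × H | inner ℂ x v.2 =
        inner ℂ (Q k (y - ContinuousLinearMap.adjoint (B k) x)) v.1}) (fun w hw => ?_)
        (isClosed_eq (by fun_prop) (by fun_prop)) hv
    change inner ℂ x w.2 = inner ℂ (Q k (y - ContinuousLinearMap.adjoint (B k) x)) w.1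
    induction hw using Submodule.iSup_induction' with
    | mem l w hw =>
      obtain ⟨h1, h2⟩ := mem_blockGraph.1 hw
      have h3 := snd_mem_of_mem_blockGraph (hDK l) (hB l) hw
      rw [hQ.inner_left]
      by_cases hkl : k = l
      · subst hkl
        rw [hQ.apply_of_mem _ _ h1, inner_sub_left, ContinuousLinearMap.adjoint_inner_left,
          hD.inner_graph hxy h2, inner_add_right, add_sub_cancel_right]
      · rw [hQ.apply_of_mem_of_ne hkl h1, inner_zero_right, hQ.orthogonal k l hkl x hx _ h3]
    | zero => simp
    | add u w _ _ hu hw => simp only [Prod.fst_add, Prod.snd_add, inner_add_right, hu, hw]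
  refine hQ.total _ fun k => hD.eq_zero_of_inner_domain fun x y hxy => ?_
  rw [← hQ.inner_left, key k _ _ (hQ.mem k x) (hQD k x y hxy), hv0, inner_zero_right]

theorem blockSum_eq_zero_of_fst_eq_zero (hD : IsSelfAdjoint D)
    (hQD : ∀ k x y, (x, y) ∈ D.graph → (Q k x, Q k y) ∈ D.graph)
    (hDK : ∀ k, ∀ x ∈ K k, ∀ y, (x, y) ∈ D.graph → y ∈ K k)
    (hB : ∀ k, ∀ x ∈ K k, B k x ∈ K k) {v : H × H}
    (hv : v ∈ ⨆ k, blockGraph D (K k) (B k)) (hv0 : v.1 = 0) : v.2 = 0 :=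
  hQ.eq_zero_of_mem_closure_blockGraph hD hQD hDK hB
    (Submodule.le_topologicalClosure _ hv) hv0

theorem isClosable_blockSum (hD : IsSelfAdjoint D)
    (hQD : ∀ k x y, (x, y) ∈ D.graph → (Q k x, Q k y) ∈ D.graph)
    (hDK : ∀ k, ∀ x ∈ K k, ∀ y, (x, y) ∈ D.graph → y ∈ K k)
    (hB : ∀ k, ∀ x ∈ K k, B k x ∈ K k) {G : H →ₗ.[ℂ] H}
    (hG : G.graph = ⨆ k, blockGraph D (K k) (B k)) : G.IsClosable := by
  refine ⟨G.graph.topologicalClosure.toLinearPMap, ?_⟩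
  refine (Submodule.toLinearPMap_graph_eq _ fun v hv hv0 => ?_).symm
  rw [hG] at hv
  exact hQ.eq_zero_of_mem_closure_blockGraph hD hQD hDK hB hv hv0

/-- $Q_k$ maps the dense domain of $D$ into $K_k\cap\mathrm{Dom}\,D$ and fixes $K_k$, so continuity
transports density. -/
theorem topologicalClosure_map_fst_blockGraph (hD : IsSelfAdjoint D)
    (hQD : ∀ k x y, (x, y) ∈ D.graph → (Q k x, Q k y) ∈ D.graph)
    (hK : ∀ k, IsClosed (K k : Set H)) (k : ι) :
    ((blockGraph D (K k) (B k)).map (LinearMap.fst ℂ H H)).topologicalClosure = K k := by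
  apply le_antisymm
  · refine Submodule.topologicalClosure_minimal _ ?_ (hK k)
    rintro _ ⟨v, hv, rfl⟩
    exact hv.1
  · intro x hx
    have h1 : x ∈ closure (D.domain : Set H) := hD.dense_domain x
    have h2 := image_closure_subset_closure_image (Q k).continuous (Set.mem_image_of_mem (Q k) h1)
    rw [hQ.apply_of_mem k x hx] at h2
    refine closure_mono ?_ h2
    rintro _ ⟨u, hu, rfl⟩
    exact ⟨(Q k u, Q k (D ⟨u, hu⟩) - B k (Q k u)), mem_blockGraph.2 ⟨hQ.mem k u, by
      rw [sub_add_cancel]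
      exact hQD k _ _ (D.mem_graph ⟨u, hu⟩)⟩, rfl⟩

/-- A Hilbert sum of bounded self-adjoint perturbations of the parts of a self-adjoint operator is
essentially self-adjoint. -/
theorem isSelfAdjoint_closure_blockSum (hD : IsSelfAdjoint D)
    (hQD : ∀ k x y, (x, y) ∈ D.graph → (Q k x, Q k y) ∈ D.graph)
    (hDK : ∀ k, ∀ x ∈ K k, ∀ y, (x, y) ∈ D.graph → y ∈ K k)
    (hB : ∀ k, ∀ x ∈ K k, B k x ∈ K k) (hBsa : ∀ k, IsSelfAdjoint (B k)) {G : H →ₗ.[ℂ] H}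
    (hG : G.graph = ⨆ k, blockGraph D (K k) (B k)) : IsSelfAdjoint G.closure := by
  have hcl := (hQ.isClosable_blockSum hD hQD hDK hB hG).graph_closure_eq_closure_graph
  rw [hG] at hcl
  have hBs : ∀ k x y, inner ℂ (B k x) y = inner ℂ x (B k y) := fun k x y =>
    (ContinuousLinearMap.isSelfAdjoint_iff_isSymmetric.1 (hBsa k)) x y
  have hblock : ∀ k v, v ∈ blockGraph D (K k) (B k) → v ∈ G.closure.graph := fun k v hv => by
    rw [← hcl]
    exact Submodule.le_topologicalClosure _ (Submodule.mem_iSup_of_mem k hv)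
  have hQblock : ∀ k x y, (x, y) ∈ D.graph → (Q k x, Q k y - B k (Q k x)) ∈ G.closure.graph :=
    fun k x y hxy => hblock k _ (mem_blockGraph.2 ⟨hQ.mem k x, by
      rw [sub_add_cancel]
      exact hQD k x y hxy⟩)
  have hdense : Dense (G.closure.domain : Set H) := by
    rw [Submodule.dense_iff_topologicalClosure_eq_top, Submodule.topologicalClosure_eq_top_iff,
      Submodule.eq_bot_iff]
    intro u hu
    refine hQ.total _ fun k => hD.eq_zero_of_inner_domain fun x y hxy => ?_
    rw [← hQ.inner_left]
    exact (Submodule.mem_orthogonal _ _).1 hu _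
      (LinearPMap.mem_domain_of_mem_graph (hQblock k x y hxy))
  rw [LinearPMap.isSelfAdjoint_def]
  apply LinearPMap.eq_of_eq_graph
  rw [LinearPMap.adjoint_graph_eq_graph_adjoint hdense]
  apply le_antisymm
  · rintro ⟨u, w⟩ huw
    rw [Submodule.mem_adjoint_iff] at huw
    -- Testing an adjoint pair $(u,w)$ against block $k$ alone puts $(Q_ku,\,Q_kw+B_kQ_ku)$ in the
    -- graph of $D^*=D$. Summing over $k$ then uses only closedness, so the sizes of the $B_k$ are
    -- irrelevant.
    have hk : ∀ k, (Q k u, Q k w) ∈ G.closure.graph := by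
      intro k
      refine hblock k _ (mem_blockGraph.2 ⟨hQ.mem k u, hD.mem_graph_of_inner fun x y hxy => ?_⟩)
      have h1 := sub_eq_zero.1 (huw _ _ (hQblock k x y hxy))
      have h2 : inner ℂ (B k (Q k x)) u = inner ℂ x (B k (Q k u)) := by
        rw [← hQ.apply_of_mem _ _ (hB k _ (hQ.mem k x)), hQ.inner_left, hBs, hQ.inner_left,
          hQ.apply_of_mem _ _ (hB k _ (hQ.mem k u))]
      rw [inner_sub_left, h2, hQ.inner_left, hQ.inner_left] at h1
      rw [inner_add_right, ← h1, sub_add_cancel]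
    have hcl' : IsClosed (G.closure.graph : Set (H × H)) := by
      rw [← hcl]
      exact Submodule.isClosed_topologicalClosure _
    refine hcl'.mem_of_tendsto ((hQ.tendsto_sum u).prodMk_nhds (hQ.tendsto_sum w))
      (Filter.Eventually.of_forall fun F => ?_)
    have := Submodule.sum_mem G.closure.graph (t := F) fun k _ => hk k
    rwa [show ∑ k ∈ F, (Q k u, Q k w) = (∑ k ∈ F, Q k u, ∑ k ∈ F, Q k w) from
      Prod.ext Prod.fst_sum Prod.snd_sum] at this
  · have hsymm : ∀ v ∈ ⨆ k, blockGraph D (K k) (B k), ∀ w ∈ ⨆ k, blockGraph D (K k) (B k),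
        inner ℂ w.2 v.1 = inner ℂ w.1 v.2 := by
      intro v hv w hw
      induction hv using Submodule.iSup_induction' with
      | mem k v hv =>
        induction hw using Submodule.iSup_induction' with
        | mem l w hw =>
          by_cases hkl : l = k
          · subst hkl
            have h1 := hD.inner_graph hw.2 hv.2
            simp only [LinearMap.add_apply, LinearMap.comp_apply,
              LinearMap.fst_apply, LinearMap.snd_apply, ContinuousLinearMap.coe_coe,
              inner_add_left, inner_add_right, hBs] at h1
            exact add_right_cancel h1
          · rw [hQ.orthogonal l k hkl _ (snd_mem_of_mem_blockGraph (hDK l) (hB l) hw) v.1 hv.1,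
              hQ.orthogonal l k hkl w.1 hw.1 _ (snd_mem_of_mem_blockGraph (hDK k) (hB k) hv)]
        | zero => simp
        | add u w _ _ hu hw => simp only [Prod.fst_add, Prod.snd_add, inner_add_left, hu, hw]
      | zero => simp
      | add u w _ _ hu hw => simp only [Prod.fst_add, Prod.snd_add, inner_add_right, hu, hw]
    rw [← hcl]
    intro v hv
    rw [Submodule.mem_adjoint_iff]
    intro a b hab
    refine sub_eq_zero.2 ?_
    refine closure_minimal (t := {w : H × H | inner ℂ w.2 v.1 = inner ℂ w.1 v.2})
      (fun w hw => ?_) (isClosed_eq (by fun_prop) (by fun_prop)) hab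
    exact closure_minimal (t := {v : H × H | inner ℂ w.2 v.1 = inner ℂ w.1 v.2})
      (fun v hv => hsymm v hv w hw) (isClosed_eq (by fun_prop) (by fun_prop)) hv

end IsProjectionFamily
end BlockOperators

/-! ### The anti-automorphism $X\mapsto JX^*J^{-1}$ -/

section ConjAdjoint

variable {H : Type*} [NormedAddCommGroup H] [InnerProductSpace ℂ H] [CompleteSpace H]
  (J : H ≃ₗᵢ⋆[ℂ] H)

omit [CompleteSpace H] in
-- Polarization: $J$ preserves norms, and its conjugate-linearity swaps the two imaginary terms.
theorem LinearIsometryEquiv.inner_map_map_antiunitary (x y : H) :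
    inner ℂ (J x) (J y) = inner ℂ y x := by
  have hI : (RCLike.I : ℂ) = Complex.I := rfl
  have h1 : ∀ u : H, (Complex.I : ℂ) • J u = -J (Complex.I • u) := by
    intro u
    rw [map_smulₛₗ, Complex.conj_I, neg_smul, neg_neg]
  rw [← inner_conj_symm y x, inner_eq_sum_norm_sq_div_four (J x) (J y),
    inner_eq_sum_norm_sq_div_four x y]
  simp only [hI, h1, sub_neg_eq_add, ← sub_eq_add_neg (J x), ← map_add J, ← map_sub J,
    LinearIsometryEquiv.norm_map]
  have h4 : (starRingEnd ℂ) 4 = 4 := map_ofNat _ 4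
  simp [h4]
  ring

theorem conjAdjoint_apply (X : H →L[ℂ] H) (x : H) :
    conjAdjoint J X x = J (ContinuousLinearMap.adjoint X (J.symm x)) := rfl

/-- `conjAdjoint` as a linear map. -/
def conjAdjointₗ : (H →L[ℂ] H) →ₗ[ℂ] H →L[ℂ] H where
  toFun := conjAdjoint J
  map_add' X Y := by
    ext x
    simp [conjAdjoint_apply]
  map_smul' c X := by
    ext x
    simp [conjAdjoint_apply, map_smulₛₗ]

theorem conjAdjointₗ_apply (X : H →L[ℂ] H) : conjAdjointₗ J X = conjAdjoint J X := rfl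

theorem conjAdjoint_one : conjAdjoint J 1 = 1 := by
  ext x
  simp [conjAdjoint_apply, ← ContinuousLinearMap.star_eq_adjoint]

theorem conjAdjoint_mul (X Y : H →L[ℂ] H) :
    conjAdjoint J (X * Y) = conjAdjoint J Y * conjAdjoint J X := by
  ext x
  simp [conjAdjoint_apply, ← ContinuousLinearMap.star_eq_adjoint]

theorem adjoint_conjAdjoint (X : H →L[ℂ] H) :
    ContinuousLinearMap.adjoint (conjAdjoint J X) =
      conjAdjoint J (ContinuousLinearMap.adjoint X) := by
  symm
  rw [ContinuousLinearMap.eq_adjoint_iff]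
  intro x y
  obtain ⟨x, rfl⟩ := J.surjective x
  obtain ⟨y, rfl⟩ := J.surjective y
  simp [conjAdjoint_apply, J.inner_map_map_antiunitary, ContinuousLinearMap.adjoint_inner_left]

variable {J} {e : ℤ}

omit [CompleteSpace H] in
theorem symm_apply_of_sq (hJ : ∀ x, J (J x) = e • x) (he : e * e = 1) (x : H) :
    J.symm x = e • J x := by
  rw [LinearIsometryEquiv.symm_apply_eq, map_zsmul, hJ, smul_smul, he, one_smul]

theorem conjAdjoint_conjAdjoint (hJ : ∀ x, J (J x) = e • x) (he : e * e = 1) (X : H →L[ℂ] H) :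
    conjAdjoint J (conjAdjoint J X) = X := by
  ext x
  rw [conjAdjoint_apply, adjoint_conjAdjoint, conjAdjoint_apply,
    ContinuousLinearMap.adjoint_adjoint, hJ, symm_apply_of_sq hJ he (J.symm x),
    LinearIsometryEquiv.apply_symm_apply, map_zsmul, smul_smul, he, one_smul]

theorem Commute.conjAdjoint {X Y : H →L[ℂ] H} (h : Commute X Y) :
    Commute (conjAdjoint J X) (conjAdjoint J Y) := by
  have := congrArg (_root_.conjAdjoint J) h.eq
  rw [conjAdjoint_mul, conjAdjoint_mul] at this
  exact this.symm

/-- The minus sign comes from the adjoint of a commutator, the factor $c$ from moving $T$ past $J$.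
With $T=D$ this gives the sign in `rightForm`; with $T=\delta_j$ and $c=-1$ the signs cancel. -/
theorem IsCommutator.conjAdjoint {T : H →ₗ.[ℂ] H} (hT : IsSelfAdjoint T) {b s : H →L[ℂ] H}
    (h : IsCommutator T b s) {c : ℤ} (hc : c * c = 1) (hJT : IntertwinesUpTo c T J)
    (hJ : ∀ x, J (J x) = e • x) (he : e * e = 1) :
    IsCommutator T (conjAdjoint J b) (-(c • conjAdjoint J s)) := by
  rw [isCommutator_iff_graph]
  intro x y hxy
  have h1 : (J.symm x, c • J.symm y) ∈ T.graph := by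
    have := zsmul_mem (hJT.mem_graph hxy) e
    rw [Prod.smul_mk, smul_comm] at this
    rwa [symm_apply_of_sq hJ he, symm_apply_of_sq hJ he]
  have h2 := hJT.mem_graph (isCommutator_iff_graph.1 (h.adjoint hT) _ _ h1)
  rw [map_add, map_zsmul, map_zsmul, smul_add, smul_smul, hc, one_smul, neg_apply, map_neg,
    smul_neg] at h2
  exact h2

end ConjAdjoint

theorem krEps_mul_self (d : ℕ) : krEps d * krEps d = 1 := by
  unfold krEps
  split_ifs <;> norm_num

theorem krEps'_mul_self (d : ℕ) : krEps' d * krEps' d = 1 := by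
  unfold krEps'
  split_ifs <;> norm_num

/-! ### Right action and weight spaces of an equivariant triple -/

namespace RealSpectralTriple

variable {A : Type*} [Ring A] [StarRing A] [Algebra ℂ A] [StarModule ℂ A]
  {H : Type*} [NormedAddCommGroup H] [InnerProductSpace ℂ H] [CompleteSpace H] {d : ℕ}
  (T : RealSpectralTriple A H d)

theorem isCommutator_diff (a : A) : IsCommutator T.D (T.π a) (T.diff a) := by
  have h := T.bounded_commutator a
  rw [diff, boundedCommutator, dif_pos h]
  exact h.choose_spec

theorem rightMul_one : T.rightMul 1 = 1 := by rw [rightMul, map_one, conjAdjoint_one]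

theorem rightMul_mul (a b : A) : T.rightMul (a * b) = T.rightMul b * T.rightMul a := by
  rw [rightMul, map_mul, conjAdjoint_mul]
  rfl

theorem rightMul_sum {ι : Type*} (s : Finset ι) (a : ι → A) :
    T.rightMul (∑ t ∈ s, a t) = ∑ t ∈ s, T.rightMul (a t) := by
  simp only [rightMul, map_sum, ← conjAdjointₗ_apply]

/-- `h [D, p] = D (h p) - (D h) p`. -/
theorem isCommutator_rightMul (p : A) :
    IsCommutator T.D (T.rightMul p) (T.rightForm (T.diff p)) := by
  have := (T.isCommutator_diff p).conjAdjoint T.selfAdjoint (krEps'_mul_self d) T.J_D T.J_sq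
    (krEps_mul_self d)
  rwa [← neg_smul] at this

theorem rightForm_mul (p : A) (η : H →L[ℂ] H) :
    T.rightForm (T.π p * η) = T.rightForm η * T.rightMul p := by
  rw [rightForm, rightForm, conjAdjoint_mul, smul_mul_assoc]
  rfl

theorem rightForm_isSelfAdjoint {η : H →L[ℂ] H} (h : IsSelfAdjoint η) :
    IsSelfAdjoint (T.rightForm η) := by
  have h' : ContinuousLinearMap.adjoint η = η := h
  have : IsSelfAdjoint (conjAdjoint T.J η) := by
    rw [isSelfAdjoint_iff, ContinuousLinearMap.star_eq_adjoint, adjoint_conjAdjoint, h']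
  rw [rightForm, isSelfAdjoint_iff, star_zsmul, this.star_eq]

/-- The right action of one-forms commutes with the left action of the algebra. -/
theorem commute_rightForm {η : H →L[ℂ] H} (hη : η ∈ T.oneForms ⊤) (a : A) :
    Commute (T.rightForm η) (T.π a) := by
  have h1 : ∀ b, Commute (conjAdjoint T.J (T.π b)) (T.π a) := fun b => (T.commutant a b).symm
  -- This is the first-order condition conjugated by $J$; since the conjugation is involutive,
  -- $Ja^*J^{-1}$ becomes $a$ again.
  have h2 : ∀ b, Commute (conjAdjoint T.J (T.diff b)) (T.π a) := by
    intro b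
    have := (T.first_order b a).conjAdjoint (J := T.J)
    rwa [conjAdjoint_conjAdjoint T.J_sq (krEps_mul_self d)] at this
  have h3 : Commute (conjAdjoint T.J η) (T.π a) := by
    induction hη using Submodule.span_induction with
    | mem η hη =>
      obtain ⟨b, -, c, -, rfl⟩ := hη
      rw [conjAdjoint_mul]
      exact (h2 c).mul_left (h1 b)
    | zero => rw [← conjAdjointₗ_apply, map_zero]; exact Commute.zero_left _
    | add x y _ _ hx hy => rw [← conjAdjointₗ_apply, map_add]; exact hx.add_left hy
    | smul c x _ hx => rw [← conjAdjointₗ_apply, map_smul]; exact hx.smul_left c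
  exact h3.smul_left _

namespace TorusEquivariance

variable {T} {n : ℕ} {C : TorusComoduleAlgebra n A} (E : T.TorusEquivariance C)

theorem mem_weightSpace {k : Fin n → ℤ} {x : H} :
    x ∈ E.weightSpace k ↔ ∀ j, x ∈ unboundedEigenspace (E.δ j) (k j) := by
  rw [weightSpace, Submodule.mem_iInf]
  rfl

theorem spectrum_subset (j : Fin n) :
    unboundedSpectrum (E.δ j) ⊆ Set.range (fun m : ℤ => (m : ℂ)) := (E.spectrum_eq j).subset

theorem isClosed_weightSpace (k : Fin n → ℤ) : IsClosed (E.weightSpace k : Set H) := by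
  have : (E.weightSpace k : Set H) = ⋂ j, (unboundedEigenspace (E.δ j) (k j) : Set H) := by
    ext x
    simp [mem_weightSpace]
  rw [this]
  exact isClosed_iInter fun j => (E.selfAdjoint j).isClosed_eigenspace _

theorem exists_weightProjections : ∃ Q : (Fin n → ℤ) → H →L[ℂ] H,
    IsProjectionFamily E.weightSpace Q ∧
    ∀ k x y, (x, y) ∈ T.D.graph → (Q k x, Q k y) ∈ T.D.graph := by
  obtain ⟨Q, hsa, hmem, hid, hT, htot, -⟩ :=
    exists_jointProjections E.selfAdjoint E.commute E.spectrum_subset Finset.univ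
  refine ⟨Q, ⟨hsa, fun k x => E.mem_weightSpace.2 fun j => hmem k x j (Finset.mem_univ j),
    fun k x hx => hid k x fun j _ => E.mem_weightSpace.1 hx j, htot, fun k l hkl x hx y hy => ?_⟩,
    hT T.D T.selfAdjoint.isClosed_graph E.commute_D⟩
  obtain ⟨j, hj⟩ := Function.ne_iff.1 hkl
  exact (E.selfAdjoint j).inner_eigenspace hj (E.mem_weightSpace.1 hx j) (E.mem_weightSpace.1 hy j)

theorem snd_mem_weightSpace (k : Fin n → ℤ) (x : H) (hx : x ∈ E.weightSpace k) (y : H)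
    (hxy : (x, y) ∈ T.D.graph) : y ∈ E.weightSpace k := by
  rw [mem_weightSpace] at hx ⊢
  intro j
  obtain ⟨R, hR⟩ := exists_resolvent_of_integer_spectrum (E.spectrum_subset j) 0
  exact (E.commute_D j).mem_eigenspace (by simp) hR (hx j) hxy

theorem π_mem_weightSpace {k l : Fin n → ℤ} {a : A} (ha : a ∈ C.homogeneous k) {x : H}
    (hx : x ∈ E.weightSpace l) : T.π a x ∈ E.weightSpace (l + k) := by
  rw [mem_weightSpace] at hx ⊢
  intro j
  rw [Pi.add_apply, Int.cast_add]
  refine (E.leibniz j a).mem_eigenspace ?_ (hx j)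
  rw [C.deriv_of_mem_homogeneous ha, map_smul]

/-- Both the adjoint and the conjugation by $J$ reverse degrees, so the right action raises weight
by $k$, just as the left action does. -/
theorem rightMul_mem_weightSpace {k l : Fin n → ℤ} {a : A} (ha : a ∈ C.homogeneous k) {x : H}
    (hx : x ∈ E.weightSpace l) : T.rightMul a x ∈ E.weightSpace (l + k) := by
  rw [mem_weightSpace] at hx ⊢
  intro j
  rw [Pi.add_apply, Int.cast_add]
  refine ((E.leibniz j a).conjAdjoint (E.selfAdjoint j) (c := -1) (by norm_num)
    (E.anticommute_J j) T.J_sq (krEps_mul_self d)).mem_eigenspace ?_ (hx j)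
  rw [C.deriv_of_mem_homogeneous ha, map_smul, ← conjAdjointₗ_apply, map_smul, conjAdjointₗ_apply,
    neg_smul, one_smul, neg_neg]

theorem rightForm_mem_weightSpace {η : H →L[ℂ] H} (hη : ∀ j, IsCommutator (E.δ j) η 0)
    {k : Fin n → ℤ} {x : H} (hx : x ∈ E.weightSpace k) : T.rightForm η x ∈ E.weightSpace k := by
  refine zsmul_mem (K := E.weightSpace k) (x := conjAdjoint T.J η x) ?_ (-krEps' d)
  rw [mem_weightSpace] at hx ⊢
  intro j
  have := ((hη j).conjAdjoint (E.selfAdjoint j) (c := -1) (by norm_num)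
    (E.anticommute_J j) T.J_sq (krEps_mul_self d)).mem_eigenspace (c := 0) ?_ (hx j)
  · rwa [add_zero] at this
  · rw [← conjAdjointₗ_apply, map_zero, smul_zero, neg_zero, zero_smul]

/-- The weight spaces are generated by `H_0` under the right action. -/
theorem eq_sum_rightMul (hC : C.IsPrincipal) (k : Fin n → ℤ) :
    ∃ (r : ℕ) (a b : Fin r → A), (∀ t, b t ∈ C.homogeneous k) ∧
      (∀ t, ∀ x ∈ E.weightSpace k, T.rightMul (a t) x ∈ E.weightSpace 0) ∧
      ∀ x, ∑ t, T.rightMul (b t) (T.rightMul (a t) x) = x := by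
  obtain ⟨r, a, b, ha, hb, hab⟩ := hC.exists_sum_eq_one k
  refine ⟨r, a, b, hb, fun t x hx => ?_, fun x => ?_⟩
  · have := E.rightMul_mem_weightSpace (ha t) hx
    rwa [add_neg_cancel] at this
  · have := congrArg (fun X : H →L[ℂ] H => X x) (congrArg T.rightMul hab)
    simpa [rightMul_sum, rightMul_mul, rightMul_one, sum_apply] using this

end TorusEquivariance
end RealSpectralTriple

/-! ### The twisted blocks as bounded perturbations of $D$ -/

namespace RealSpectralTriple

variable {A : Type*} [Ring A] [StarRing A] [Algebra ℂ A] [StarModule ℂ A]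
  {H : Type*} [NormedAddCommGroup H] [InnerProductSpace ℂ H] [CompleteSpace H] {d : ℕ}
  {T : RealSpectralTriple A H d}

theorem mem_horizontalDirac_graph {n : ℕ} {Γ : H →L[ℂ] H} {x y : H} :
    (x, y) ∈ (T.horizontalDirac n Γ).graph ↔ ∃ u v, (x, u) ∈ T.D.graph ∧ (Γ x, v) ∈ T.D.graph ∧
      y = (1 / 2 : ℂ) • Γ (Γ u + (-1 : ℂ) ^ n • v) := by
  rw [LinearPMap.mem_graph_iff_exists]
  constructor
  · rintro ⟨h, rfl⟩
    exact ⟨_, _, T.D.mem_graph ⟨x, h.1⟩, T.D.mem_graph ⟨Γ x, h.2⟩, rfl⟩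
  · rintro ⟨u, v, hu, hv, rfl⟩
    obtain ⟨h1, rfl⟩ := LinearPMap.mem_graph_iff_exists.1 hu
    obtain ⟨h2, rfl⟩ := LinearPMap.mem_graph_iff_exists.1 hv
    exact ⟨⟨h1, h2⟩, rfl⟩

namespace TorusEquivariance

variable {n : ℕ} {C : TorusComoduleAlgebra n A} (E : T.TorusEquivariance C) {Γ : H →L[ℂ] H}

theorem horizontalDirac_mem_weightSpace (hΓ : E.IsProjectable Γ) {k : Fin n → ℤ} {x y : H}
    (hx : x ∈ E.weightSpace k) (hxy : (x, y) ∈ (T.horizontalDirac n Γ).graph) :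
    y ∈ E.weightSpace k := by
  have hΓk : ∀ z ∈ E.weightSpace k, Γ z ∈ E.weightSpace k := by
    intro z hz
    rw [mem_weightSpace] at hz ⊢
    intro j
    have := commutesUpTo_iff_graph.1 (hΓ.commute_δ j) _ _ (mem_unboundedEigenspace.1 (hz j))
    rw [mem_unboundedEigenspace]
    simpa using this
  obtain ⟨u, v, hu, hv, rfl⟩ := mem_horizontalDirac_graph.1 hxy
  refine (E.weightSpace k).smul_mem _ (hΓk _ ((E.weightSpace k).add_mem (hΓk _ ?_)
    ((E.weightSpace k).smul_mem _ ?_)))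
  · exact E.snd_mem_weightSpace k x hx u hu
  · exact E.snd_mem_weightSpace k _ (hΓk x hx) v hv

/-- With isometric fibres, `D_0` is a bounded self-adjoint perturbation of the restriction of `D`
to `H_0`. -/
theorem HasIsometricFibres.exists_potential {E : T.TorusEquivariance C}
    (hfib : E.HasIsometricFibres Γ) :
    ∃ Z : H →L[ℂ] H, IsSelfAdjoint Z ∧ (∀ a, Commute Z (T.π a)) ∧
      (∀ a, Commute Z (T.rightMul a)) ∧ ∀ x ∈ E.weightSpace 0, ∀ y,
        (x, y) ∈ (T.horizontalDirac n Γ).graph ↔ (x, y + Z x) ∈ T.D.graph := by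
  obtain ⟨Dv, Z, hD, hDv, -, -, hZπ, Z', hZ', hZZ'⟩ := hfib
  -- Taking $a=1$ identifies $Z$ with $Z'$, which makes $Z$ self-adjoint and commuting with the
  -- right action.
  have hZeq : Z = Z' := by
    have := hZZ' 1
    rwa [T.rightMul_one, one_mul, mul_one] at this
  subst hZeq
  refine ⟨Z, hZ', hZπ, fun a => (hZZ' a).symm, fun x hx y => ?_⟩
  -- The equality of domains in $D=D_v+D_h+Z$ matters here:
  -- $\mathrm{Dom}\,D=\mathrm{Dom}\,D_v\cap\mathrm{Dom}\,D_h$.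
  have hgr : ∀ w, (x, w) ∈ T.D.graph ↔
      ∃ h : x ∈ Dv.domain ⊓ (T.horizontalDirac n Γ).domain,
        Z x + (Dv ⟨x, h.1⟩ + T.horizontalDirac n Γ ⟨x, h.2⟩) = w := by
    intro w
    conv_lhs => rw [hD]
    exact LinearPMap.mem_graph_iff_exists
  constructor
  · intro h
    obtain ⟨h1, rfl⟩ := LinearPMap.mem_graph_iff_exists.1 h
    obtain ⟨u, v, hu, -⟩ := mem_horizontalDirac_graph.1 h
    obtain ⟨h2, -⟩ := (hgr u).1 hu
    refine (hgr _).2 ⟨h2, ?_⟩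
    rw [hDv ⟨x, h2.1⟩ hx, zero_add, add_comm]
  · intro h
    obtain ⟨h2, h3⟩ := (hgr _).1 h
    rw [hDv ⟨x, h2.1⟩ hx, zero_add, add_comm] at h3
    exact LinearPMap.mem_graph_iff_exists.2 ⟨h2.2, add_right_cancel h3⟩

variable {Z : H →L[ℂ] H}

/-- $Z$ is not assumed to commute with the $\delta_j$. On the dense subspace $\mathcal
H_0\cap\mathrm{Dom}\,D$ it equals $D-D_h$, and both terms preserve $\mathcal H_0$. Principality
carries the result from $\mathcal H_0$ to $\mathcal H_k$, because $Z$ commutes with the right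
action. -/
theorem potential_mem_weightSpace (hC : C.IsPrincipal) (hΓ : E.IsProjectable Γ)
    (hZr : ∀ a, Commute Z (T.rightMul a))
    (hZ : ∀ x ∈ E.weightSpace 0, ∀ y,
      (x, y) ∈ (T.horizontalDirac n Γ).graph ↔ (x, y + Z x) ∈ T.D.graph)
    (k : Fin n → ℤ) (x : H) (hx : x ∈ E.weightSpace k) : Z x ∈ E.weightSpace k := by
  have h0 : ∀ x ∈ E.weightSpace 0, Z x ∈ E.weightSpace 0 := by
    obtain ⟨Q, hQ, hQD⟩ := E.exists_weightProjections
    have h1 := hQ.topologicalClosure_map_fst_blockGraph (B := fun _ => 0) T.selfAdjoint hQD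
      E.isClosed_weightSpace 0
    intro x hx
    rw [← h1] at hx
    refine closure_minimal (t := Z ⁻¹' (E.weightSpace 0 : Set H)) ?_
      ((E.isClosed_weightSpace 0).preimage Z.continuous) hx
    rintro _ ⟨⟨u, v⟩, huv, rfl⟩
    obtain ⟨hu, huv⟩ := mem_blockGraph.1 huv
    rw [zero_apply, add_zero] at huv
    have h2 := E.horizontalDirac_mem_weightSpace hΓ hu
      ((hZ u hu (v - Z u)).2 (by rwa [sub_add_cancel]))
    have h3 := (E.weightSpace 0).sub_mem (E.snd_mem_weightSpace 0 u hu v huv) h2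
    rwa [sub_sub_cancel] at h3
  obtain ⟨r, a, b, hb, ha, hab⟩ := E.eq_sum_rightMul hC k
  rw [← hab x, map_sum]
  refine Submodule.sum_mem _ fun t _ => ?_
  have h1 : Z (T.rightMul (b t) (T.rightMul (a t) x)) =
      T.rightMul (b t) (Z (T.rightMul (a t) x)) :=
    congrArg (fun X : H →L[ℂ] H => X (T.rightMul (a t) x)) (hZr (b t)).eq
  rw [h1]
  simpa using E.rightMul_mem_weightSpace (hb t) (h0 _ (ha t x hx))

/-- The bounded operator `D - D_ω` on `H_k`. -/
def twistPotential (T : RealSpectralTriple A H d) (Z : H →L[ℂ] H) (ω : Fin n → H →L[ℂ] H)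
    (k : Fin n → ℤ) : H →L[ℂ] H :=
  Z + ∑ i, (k i : ℂ) • T.rightForm (ω i)

theorem twistPotential_apply (ω : Fin n → H →L[ℂ] H) (k : Fin n → ℤ) (x : H) :
    twistPotential T Z ω k x = Z x + ∑ i, (k i : ℂ) • T.rightForm (ω i) x := by
  simp [twistPotential, sum_apply]

theorem twistPotential_isSelfAdjoint (hZ : IsSelfAdjoint Z) {ω : Fin n → H →L[ℂ] H}
    (hω : ∀ i, IsSelfAdjoint (ω i)) (k : Fin n → ℤ) : IsSelfAdjoint (twistPotential T Z ω k) := by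
  refine hZ.add (isSelfAdjoint_sum _ fun i _ => ?_)
  refine IsSelfAdjoint.smul ?_ (T.rightForm_isSelfAdjoint (hω i))
  rw [isSelfAdjoint_iff, RCLike.star_def, map_intCast]

theorem rightForm_connection (ω : Fin n → H →L[ℂ] H) (k : Fin n → ℤ) (p : A) (x : H) :
    T.rightForm (connection (T := T) ω k p) x = T.rightForm (T.diff p) x -
      ∑ i, (k i : ℂ) • T.rightForm (ω i) (T.rightMul p x) := by
  have h1 : T.rightForm (connection (T := T) ω k p) = T.rightForm (T.diff p) -
      ∑ i, (k i : ℂ) • T.rightForm (T.π p * ω i) := by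
    simp only [rightForm, connection, ← conjAdjointₗ_apply, map_sub, map_sum, map_smul, smul_sub,
      Finset.smul_sum, smul_comm (-krEps' d)]
  rw [h1]
  simp [sum_apply, rightForm_mul]

theorem mem_baseDirac_graph {x y : H} : (x, y) ∈ (E.baseDirac Γ).graph ↔
    x ∈ E.weightSpace 0 ∧ (x, y) ∈ (T.horizontalDirac n Γ).graph := by
  rw [LinearPMap.mem_graph_iff_exists, LinearPMap.mem_graph_iff_exists]
  constructor
  · rintro ⟨h, rfl⟩
    exact ⟨h.1, h.2, rfl⟩
  · rintro ⟨h1, h2, rfl⟩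
    exact ⟨⟨h1, h2⟩, rfl⟩

/-- The prescription for `D_ω^(k)` defines the restriction of `D` minus a bounded operator. -/
theorem twistRelation_eq_blockGraph (hC : C.IsPrincipal)
    (hZr : ∀ a, Commute Z (T.rightMul a))
    (hZ : ∀ x ∈ E.weightSpace 0, ∀ y,
      (x, y) ∈ (T.horizontalDirac n Γ).graph ↔ (x, y + Z x) ∈ T.D.graph)
    (ω : Fin n → H →L[ℂ] H) (k : Fin n → ℤ) :
    E.twistRelation Γ ω k = blockGraph T.D (E.weightSpace k) (twistPotential T Z ω k) := by
  have hle : E.twistRelation Γ ω k ≤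
      blockGraph T.D (E.weightSpace k) (twistPotential T Z ω k) := by
    refine Submodule.span_le.2 ?_
    rintro _ ⟨h, p, hp, rfl⟩
    obtain ⟨h1, h2⟩ := E.mem_baseDirac_graph.1 ((E.baseDirac Γ).mem_graph h)
    refine mem_blockGraph.2 ⟨by simpa using E.rightMul_mem_weightSpace hp h1, ?_⟩
    have h3 := isCommutator_iff_graph.1 (T.isCommutator_rightMul p) _ _ ((hZ _ h1 _).1 h2)
    have h4 : Z (T.rightMul p (h : H)) = T.rightMul p (Z (h : H)) :=
      congrArg (fun X : H →L[ℂ] H => X (h : H)) (hZr p).eq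
    convert h3 using 2
    rw [rightForm_connection, twistPotential_apply, map_add, h4]
    abel
  refine le_antisymm hle ?_
  rintro ⟨x, y⟩ hxy
  obtain ⟨hx, hxy'⟩ := mem_blockGraph.1 hxy
  obtain ⟨r, a, b, hb, ha, hab⟩ := E.eq_sum_rightMul hC k
  -- The right action preserves $\mathrm{Dom}\,D$, and on $\mathcal H_0$ the domains of $D$ and
  -- $D_h$ agree.
  have hdom : ∀ t, ∃ g, (T.rightMul (a t) x, g) ∈ (E.baseDirac Γ).graph := by
    intro t
    have h1 := isCommutator_iff_graph.1 (T.isCommutator_rightMul (a t)) _ _ hxy'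
    refine ⟨T.rightMul (a t) (y + twistPotential T Z ω k x) + T.rightForm (T.diff (a t)) x -
      Z (T.rightMul (a t) x), E.mem_baseDirac_graph.2 ⟨ha t x hx, (hZ _ (ha t x hx) _).2 ?_⟩⟩
    rwa [sub_add_cancel]
  choose g hg using hdom
  have hmem : ∀ t, ∃ w, (T.rightMul (b t) (T.rightMul (a t) x), w) ∈ E.twistRelation Γ ω k := by
    intro t
    obtain ⟨h1, h2⟩ := LinearPMap.mem_graph_iff_exists.1 (hg t)
    exact ⟨_, Submodule.subset_span ⟨⟨_, h1⟩, b t, hb t, rfl⟩⟩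
  choose w hw using hmem
  have hsum := Submodule.sum_mem (E.twistRelation Γ ω k) (t := Finset.univ) fun t _ => hw t
  rw [show ∑ t, (T.rightMul (b t) (T.rightMul (a t) x), w t) = (x, ∑ t, w t) from
    Prod.ext (by rw [Prod.fst_sum]; exact hab x) Prod.snd_sum] at hsum
  -- The values $w_t$ need no computation: by the inclusion already shown, their sum is a value of
  -- the single-valued $D-B_k$ at $x$, hence equals $y$.
  have h1 := T.D.mem_graph_snd_inj hxy' (mem_blockGraph.1 (hle hsum)).2 rfl
  rwa [add_right_cancel h1]

/-- $Z$ and the right action of $\omega_i$ commute with $a$, so $B_{k+l}a-aB_k=\sum_i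
l_i\,(\cdot\,\omega_i)\,a$. The commutator is thus one bounded operator for all $k$ at once. -/
theorem commutator_mem_blockGraph (hZπ : ∀ a, Commute Z (T.π a)) {ω : Fin n → H →L[ℂ] H}
    (hω : ∀ i, ω i ∈ T.oneForms ⊤) {k l : Fin n → ℤ} {a : A} (ha : a ∈ C.homogeneous l)
    {x y : H} (hxy : (x, y) ∈ blockGraph T.D (E.weightSpace k) (twistPotential T Z ω k)) :
    (T.π a x, T.π a y + (T.diff a - ∑ i, (l i : ℂ) • (T.rightForm (ω i) * T.π a)) x) ∈
      blockGraph T.D (E.weightSpace (k + l)) (twistPotential T Z ω (k + l)) := by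
  obtain ⟨hx, hxy⟩ := mem_blockGraph.1 hxy
  refine mem_blockGraph.2 ⟨E.π_mem_weightSpace ha hx, ?_⟩
  have h1 := isCommutator_iff_graph.1 (T.isCommutator_diff a) _ _ hxy
  have h2 : Z (T.π a x) = T.π a (Z x) := congrArg (fun X : H →L[ℂ] H => X x) (hZπ a).eq
  have h3 : ∀ i, T.rightForm (ω i) (T.π a x) = T.π a (T.rightForm (ω i) x) := fun i =>
    congrArg (fun X : H →L[ℂ] H => X x) (T.commute_rightForm (hω i) a).eq
  convert h1 using 2
  simp only [twistPotential_apply, sub_apply, sum_apply, smul_apply, mul_apply_eq_comp, map_add,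
    map_sum, map_smul, h2, h3, Pi.add_apply, Int.cast_add, add_smul, Finset.sum_add_distrib]
  abel

end TorusEquivariance
end RealSpectralTriple

/-! ### Commutators on closures and the proof of the proposition -/

theorem IsCommutator.add {H : Type*} [NormedAddCommGroup H] [InnerProductSpace ℂ H]
    {T : H →ₗ.[ℂ] H} {a b S R : H →L[ℂ] H} (ha : IsCommutator T a S) (hb : IsCommutator T b R) :
    IsCommutator T (a + b) (S + R) := by
  rw [isCommutator_iff_graph] at *
  intro x y hxy
  convert T.graph.add_mem (ha x y hxy) (hb x y hxy) using 1
  rw [Prod.mk_add_mk]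
  simp only [add_apply]
  congr 1
  abel

theorem isCommutator_zero {H : Type*} [NormedAddCommGroup H] [InnerProductSpace ℂ H]
    (T : H →ₗ.[ℂ] H) : IsCommutator T 0 0 := by
  rw [isCommutator_iff_graph]
  intro x y _
  simp

/-- A bounded commutator on a closable operator is one on its closure. -/
theorem isCommutator_closure {H : Type*} [NormedAddCommGroup H] [InnerProductSpace ℂ H]
    {G : H →ₗ.[ℂ] H} (hG : G.IsClosable) {a S : H →L[ℂ] H} (h : IsCommutator G a S) :
    IsCommutator G.closure a S := by
  rw [isCommutator_iff_graph] at *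
  intro x y hxy
  rw [← hG.graph_closure_eq_closure_graph] at *
  have hc : Continuous fun v : H × H => (a v.1, a v.2 + S v.1) := by fun_prop
  exact map_mem_closure (f := fun v : H × H => (a v.1, a v.2 + S v.1)) hc hxy
    fun v hv => h v.1 v.2 hv

end

theorem mainTheorem3
    {A : Type*} [Ring A] [StarRing A] [Algebra ℂ A] [StarModule ℂ A]
    {H : Type*} [NormedAddCommGroup H] [InnerProductSpace ℂ H] [CompleteSpace H]
    {n d : ℕ} (C : TorusComoduleAlgebra n A) (hC : C.IsPrincipal)
    (T : RealSpectralTriple A H d) (E : T.TorusEquivariance C)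
    (Γ : H →L[ℂ] H) (hΓ : E.IsProjectable Γ) (hfib : E.HasIsometricFibres Γ)
    (ω : Fin n → H →L[ℂ] H) (hω : E.IsStrongConnection ω) :
    -- each twist `D_ω^(k)` is a well-defined, densely defined operator on `H_k`
    (∀ k : Fin n → ℤ,
      (E.twist Γ ω k).graph = E.twistRelation Γ ω k ∧
      (E.twist Γ ω k).domain.topologicalClosure = E.weightSpace k ∧
      ∀ x, E.twist Γ ω k x ∈ E.weightSpace k) ∧
    -- `H` is the Hilbert sum of the `H_k`, and the direct sum of the twists is a closable operator
    (OrthogonalFamily ℂ (fun k => E.weightSpace k) (fun k => (E.weightSpace k).subtypeₗᵢ) ∧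
      (⨆ k, E.weightSpace k).topologicalClosure = ⊤ ∧
      (E.twistSum Γ ω).graph = (⨆ k, (E.twist Γ ω k).graph) ∧
      (E.twistSum Γ ω).IsClosable) ∧
    -- `D_ω` is self-adjoint as soon as all the `ω_i` are
    ((∀ i, IsSelfAdjoint (ω i)) → IsSelfAdjoint (E.twistedDirac Γ ω)) ∧
    -- `D_ω` has bounded commutators with `A`
    (∀ a : A, ∃ S : H →L[ℂ] H, IsCommutator (E.twistedDirac Γ ω) (T.π a) S) := by
  obtain ⟨Z, hZsa, hZπ, hZr, hZ⟩ := hfib.exists_potential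
  obtain ⟨Q, hQ, hQD⟩ := E.exists_weightProjections
  have hB : ∀ k, ∀ x ∈ E.weightSpace k,
      RealSpectralTriple.TorusEquivariance.twistPotential T Z ω k x ∈ E.weightSpace k := by
    intro k x hx
    rw [RealSpectralTriple.TorusEquivariance.twistPotential_apply]
    exact Submodule.add_mem _ (E.potential_mem_weightSpace hC hΓ hZr hZ k x hx)
      (Submodule.sum_mem _ fun i _ => Submodule.smul_mem _ _
        (E.rightForm_mem_weightSpace (hω.invariant i) hx))
  have hrel := E.twistRelation_eq_blockGraph hC hZr hZ ω
  have hDK := E.snd_mem_weightSpace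
  have htw : ∀ k, (E.twist Γ ω k).graph = E.twistRelation Γ ω k := by
    intro k
    refine Submodule.toLinearPMap_graph_eq _ fun v hv hv0 => ?_
    rw [hrel] at hv
    exact hQ.blockSum_eq_zero_of_fst_eq_zero T.selfAdjoint hQD hDK hB
      (Submodule.mem_iSup_of_mem k hv) hv0
  have hsup : (⨆ k, (E.twist Γ ω k).graph) = ⨆ k, blockGraph T.D (E.weightSpace k)
      (RealSpectralTriple.TorusEquivariance.twistPotential T Z ω k) :=
    iSup_congr fun k => (htw k).trans (hrel k)
  have hsum : (E.twistSum Γ ω).graph = ⨆ k, (E.twist Γ ω k).graph := by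
    refine Submodule.toLinearPMap_graph_eq _ fun v hv hv0 => ?_
    rw [hsup] at hv
    exact hQ.blockSum_eq_zero_of_fst_eq_zero T.selfAdjoint hQD hDK hB hv hv0
  have hsum' := hsum.trans hsup
  have hclosable := hQ.isClosable_blockSum T.selfAdjoint hQD hDK hB hsum'
  refine ⟨fun k => ⟨htw k, ?_, fun x => ?_⟩, ⟨hQ.orthogonalFamily, hQ.topologicalClosure_iSup,
    hsum, hclosable⟩, fun hsa => ?_, fun a => ?_⟩
  · rw [← LinearPMap.graph_map_fst_eq_domain, htw, hrel]
    exact hQ.topologicalClosure_map_fst_blockGraph T.selfAdjoint hQD E.isClosed_weightSpace k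
  · have hx := (E.twist Γ ω k).mem_graph x
    rw [htw, hrel] at hx
    exact snd_mem_of_mem_blockGraph (hDK k) (hB k) hx
  · exact hQ.isSelfAdjoint_closure_blockSum T.selfAdjoint hQD hDK hB
      (RealSpectralTriple.TorusEquivariance.twistPotential_isSelfAdjoint hZsa hsa) hsum'
  -- Bounded commutators add up, and every $a$ is a finite sum of homogeneous elements, so one
  -- degree $l$ at a time suffices.
  · have ha := C.mem_iSup_homogeneous a
    induction ha using Submodule.iSup_induction' with
    | mem l a ha =>
      refine ⟨T.diff a - ∑ i, (l i : ℂ) • (T.rightForm (ω i) * T.π a),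
        isCommutator_closure hclosable (isCommutator_iff_graph.2 fun x y hxy => ?_)⟩
      have key : ∀ v ∈ (E.twistSum Γ ω).graph, (T.π a v.1, T.π a v.2 +
          (T.diff a - ∑ i, (l i : ℂ) • (T.rightForm (ω i) * T.π a)) v.1) ∈
            (E.twistSum Γ ω).graph := by
        rw [hsum']
        intro v hv
        induction hv using Submodule.iSup_induction' with
        | mem k v hv =>
          exact Submodule.mem_iSup_of_mem (k + l)
            (E.commutator_mem_blockGraph hZπ hω.mem ha hv)
        | zero =>
          rw [Prod.fst_zero, Prod.snd_zero, map_zero, map_zero, add_zero]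
          exact Submodule.zero_mem _
        | add u w _ _ hu hw =>
          convert Submodule.add_mem _ hu hw using 1
          simp only [Prod.mk_add_mk, Prod.fst_add, Prod.snd_add, map_add]
          congr 1
          abel
      exact key (x, y) hxy
    | zero => exact ⟨0, by rw [map_zero]; exact isCommutator_zero _⟩
    | add a b _ _ ha hb =>
      obtain ⟨S, hS⟩ := ha
      obtain ⟨R, hR⟩ := hb
      exact ⟨S + R, by rw [map_add]; exact hS.add hR⟩
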